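/- Let $d\ge 1$, let $q\in\mathbb{C}\setminus\{0\}$ and let $z$ be an indeterminate over $\mathbb{C}$. For $n\ge 0$ let $\mathcal F_{d,n}\cong(\mathbb Z/d\mathbb Z)^n\rtimes B_n$ be the modular framed braid group, i.e. the group generated by $\sigma_1,\dots,\sigma_{n-1},t_1,\dots,t_n$ subject to the braid relations $\sigma_i\sigma_j\sigma_i=\sigma_j\sigma_i\sigma_j$ ($|i-j|=1$), $\sigma_i\sigma_j=\sigma_j\sigma_i$ ($|i-j|>1$), and $t_it_j=t_jt_i$, $t_j\sigma_i=\sigma_it_{s_i(j)}$ with $s_i=(i,i+1)$, $t_j^d=1$ (for all $i,j$). Put $e_i=\frac1d\sum_{s=0}^{d-1}t_i^st_{i+1}^{d-s}$ for $1\le i\le n-1$. The Yokonuma--Hecke algebra $\mathrm Y_{d,n}(q)$ is the quotient of $\mathbb C\mathcal F_{d,n}$ by the two-sided ideal generated by the elements $\sigma_i^2-1-(q-q^{-1})e_i\sigma_i$, $1\le i\le n-1$; write $g_i$ for the image of $\sigma_i$, and keep the notation $t_j,e_i$ for the images of $t_j,e_i$. There are natural inclusions $\mathrm Y_{d,n}(q)\subset\mathrm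 Y_{d,n+1}(q)$ ($g_i\mapsto g_i$, $t_j\mapsto t_j$). Let $\mathrm Y_{d,n}(q)^{(\mathrm{br})}$ be the subalgebra of $\mathrm Y_{d,n}(q)$ generated by $g_1,\dots,g_{n-1}$; if $q\ne\pm1$ it contains $e_1,\dots,e_{n-1}$. For a non-empty subset $D\subseteq\mathbb Z/d\mathbb Z$ let $\mathrm x_k=\frac1{|D|}\sum_{j\in D}\exp(2\pi\sqrt{-1}\,jk/d)$, $1\le k\le d-1$, be the solution of the E-system parametrized by $D$. The specialized trace $\mathrm{tr}_{d,D}:\bigcup_{n\ge0}\mathrm Y_{d,n}(q)\to\mathbb C[z]$ is the unique $\mathbb C$-linear map satisfying, for all $n$: (1) $\mathrm{tr}_{d,D}(ab)=\mathrm{tr}_{d,D}(ba)$ for $a,b\in\mathrm Y_{d,n}(q)$; (2) $\mathrm{tr}_{d,D}(1)=1$; (3) $\mathrm{tr}_{d,D}(ag_n)=z\,\mathrm{tr}_{d,D}(a)$ for $n\ge1$, $a\in\mathrm Y_{d,n}(q)$; (4') $\mathrm{tr}_{d,D}(at_{n+1}^k)=\mathrm x_k\,\mathrm{tr}_{d,D}(a)$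 for $a\in\mathrm Y_{d,n}(q)$, $1\le k\le d-1$. **Theorem.** Let $m\in\{1,\dots,d\}$ and $E_m=1/m$. There exists a unique $\mathbb C$-linear map $\mathrm{tr}_{d,m}:\bigcup_{n\ge0}\mathrm Y_{d,n}(q)^{(\mathrm{br})}\to\mathbb C[z]$ such that, for all $n$ ($n\ge 1$ in (iii)--(v)) and all $a,b\in\mathrm Y_{d,n}(q)^{(\mathrm{br})}$, (i) $\mathrm{tr}_{d,m}(ab)=\mathrm{tr}_{d,m}(ba)$; (ii) $\mathrm{tr}_{d,m}(1)=1$; (iii) $\mathrm{tr}_{d,m}(ag_n)=z\,\mathrm{tr}_{d,m}(a)$; (iv) $\mathrm{tr}_{d,m}(ae_n)=E_m\,\mathrm{tr}_{d,m}(a)$; (v) $\mathrm{tr}_{d,m}(ae_ng_n)=z\,\mathrm{tr}_{d,m}(a)$, where (iv) and (v) are required whenever $e_n\in\mathrm Y_{d,n+1}(q)^{(\mathrm{br})}$ (in particular always when $q\neq\pm1$). Moreover, for every subset $D\subseteq\mathbb Z/d\mathbb Z$ with $|D|=m$, the specialized trace $\mathrm{tr}_{d,D}$ exists and is unique, and $\mathrm{tr}_{d,m}(a)=\mathrm{tr}_{d,D}(a)$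 for all $a\in\bigcup_{n\ge0}\mathrm Y_{d,n}(q)^{(\mathrm{br})}$. -/

import Mathlib

open scoped Polynomial

noncomputable section

namespace YokonumaHecke

/-! ### The modular framed braid group

Indices are shifted by one with respect to the usual `1`-based convention: `sigma i` (with
`i + 1 < n`) is the braiding generator usually called `σ_{i+1}`, and `framing j` (with `j : Fin n`)
is the framing generator usually called `t_{j+1}`. -/

/-- The generators of the framed braid group on `n` strands. -/
inductive Gen (n : ℕ) : Type
  | sigma (i : ℕ) (hi : i + 1 < n) : Gen n
  | framing (j : Fin n) : Gen n

/-- The transposition `s_i = (i, i+1)`. -/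
def adjSwap (n i : ℕ) (hi : i + 1 < n) : Equiv.Perm (Fin n) :=
  Equiv.swap ⟨i, by omega⟩ ⟨i + 1, hi⟩

/-- The generator `σ_i` in the free group. -/
def fσ (n i : ℕ) (hi : i + 1 < n) : FreeGroup (Gen n) := FreeGroup.of (Gen.sigma i hi)

/-- The generator `t_j` in the free group. -/
def ft (n : ℕ) (j : Fin n) : FreeGroup (Gen n) := FreeGroup.of (Gen.framing j)

/-- The defining relations `x = y` of the modular framed braid group. -/
inductive GroupRel (d n : ℕ) : FreeGroup (Gen n) → FreeGroup (Gen n) → Prop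
  | braid (i j : ℕ) (hi : i + 1 < n) (hj : j + 1 < n) (h : i = j + 1 ∨ j = i + 1) :
      GroupRel d n (fσ n i hi * fσ n j hj * fσ n i hi) (fσ n j hj * fσ n i hi * fσ n j hj)
  | far (i j : ℕ) (hi : i + 1 < n) (hj : j + 1 < n) (h : j + 1 < i ∨ i + 1 < j) :
      GroupRel d n (fσ n i hi * fσ n j hj) (fσ n j hj * fσ n i hi)
  | framing_comm (i j : Fin n) :
      GroupRel d n (ft n i * ft n j) (ft n j * ft n i)
  | framing_braid (i : ℕ) (hi : i + 1 < n) (j : Fin n) :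
      GroupRel d n (ft n j * fσ n i hi) (fσ n i hi * ft n (adjSwap n i hi j))
  | modular (j : Fin n) :
      GroupRel d n (ft n j ^ d) 1

/-- The relators of the modular framed braid group. -/
def relators (d n : ℕ) : Set (FreeGroup (Gen n)) :=
  {r | ∃ x y, GroupRel d n x y ∧ r = x * y⁻¹}

/-- The modular framed braid group `F_{d,n} ≅ (ℤ/dℤ)^n ⋊ B_n`. -/
abbrev FramedBraidGroup (d n : ℕ) : Type := PresentedGroup (relators d n)

/-- The braiding generator `σ_i` of `F_{d,n}`. -/
def σ (d n i : ℕ) (hi : i + 1 < n) : FramedBraidGroup d n := PresentedGroup.of (Gen.sigma i hi)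

/-- The framing generator `t_j` of `F_{d,n}`. -/
def tGrp (d n : ℕ) (j : Fin n) : FramedBraidGroup d n := PresentedGroup.of (Gen.framing j)

/-! ### The Yokonuma--Hecke algebra -/

/-- The group algebra `ℂ F_{d,n}`. -/
abbrev FramedBraidAlgebra (d n : ℕ) : Type := MonoidAlgebra ℂ (FramedBraidGroup d n)

/-- The element `e_i = (1/d) ∑_{s=0}^{d-1} t_i^s t_{i+1}^{d-s}` of `ℂ F_{d,n}`. -/
def eGrp (d n i : ℕ) (hi : i + 1 < n) : FramedBraidAlgebra d n :=
  (1 / (d : ℂ)) • ∑ s ∈ Finset.range d,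
    MonoidAlgebra.of ℂ (FramedBraidGroup d n)
      (tGrp d n ⟨i, by omega⟩ ^ s * tGrp d n ⟨i + 1, hi⟩ ^ (d - s))

/-- The quadratic relations `σ_i² = 1 + (q - q⁻¹) e_i σ_i`. -/
inductive QuadRel (d n : ℕ) (q : ℂ) : FramedBraidAlgebra d n → FramedBraidAlgebra d n → Prop
  | quad (i : ℕ) (hi : i + 1 < n) :
      QuadRel d n q
        (MonoidAlgebra.of ℂ (FramedBraidGroup d n) (σ d n i hi) ^ 2)
        (1 + (q - q⁻¹) • (eGrp d n i hi * MonoidAlgebra.of ℂ (FramedBraidGroup d n) (σ d n i hi)))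

/-- The Yokonuma--Hecke algebra `Y_{d,n}(q)`: the quotient of `ℂ F_{d,n}` by the two-sided ideal
generated by the elements `σ_i² - 1 - (q - q⁻¹) e_i σ_i`. -/
abbrev Y (d n : ℕ) (q : ℂ) : Type := RingQuot (QuadRel d n q)

/-- The quotient map `ℂ F_{d,n} → Y_{d,n}(q)`. -/
def proj (d n : ℕ) (q : ℂ) : FramedBraidAlgebra d n →ₐ[ℂ] Y d n q :=
  RingQuot.mkAlgHom ℂ (QuadRel d n q)

/-- The generator `g_i` of `Y_{d,n}(q)`. -/
def g (d n : ℕ) (q : ℂ) (i : ℕ) (hi : i + 1 < n) : Y d n q :=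
  proj d n q (MonoidAlgebra.of ℂ (FramedBraidGroup d n) (σ d n i hi))

/-- The generator `t_j` of `Y_{d,n}(q)`. -/
def t (d n : ℕ) (q : ℂ) (j : Fin n) : Y d n q :=
  proj d n q (MonoidAlgebra.of ℂ (FramedBraidGroup d n) (tGrp d n j))

/-- The element `e_i` of `Y_{d,n}(q)`. -/
def e (d n : ℕ) (q : ℂ) (i : ℕ) (hi : i + 1 < n) : Y d n q :=
  proj d n q (eGrp d n i hi)

/-! ### The natural inclusions `Y_{d,n}(q) ⊂ Y_{d,n+1}(q)` -/

/-- The images in `F_{d,n+1}` of the generators of `F_{d,n}`: `σ_i ↦ σ_i`, `t_j ↦ t_j`. -/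
def genIncl (d n : ℕ) : Gen n → FramedBraidGroup d (n + 1)
  | Gen.sigma i hi => σ d (n + 1) i (by omega)
  | Gen.framing j => tGrp d (n + 1) j.castSucc

theorem rel_eq {d n : ℕ} {x y : FreeGroup (Gen n)} (h : GroupRel d n x y) :
    PresentedGroup.mk (relators d n) x = PresentedGroup.mk (relators d n) y := by
  have h1 : PresentedGroup.mk (relators d n) (x * y⁻¹) = 1 :=
    PresentedGroup.one_of_mem ⟨x, y, h, rfl⟩
  rw [map_mul, map_inv, mul_inv_eq_one] at h1
  exact h1

theorem castSucc_adjSwap (n i : ℕ) (hi : i + 1 < n) (j : Fin n) :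
    (adjSwap n i hi j).castSucc = adjSwap (n + 1) i (by omega) j.castSucc := by
  unfold adjSwap
  rw [Equiv.swap_apply_def, Equiv.swap_apply_def]
  simp only [Fin.ext_iff, Fin.val_castSucc]
  split_ifs <;> simp_all

theorem genIncl_rel (d n : ℕ) :
    ∀ r ∈ relators d n, FreeGroup.lift (genIncl d n) r = 1 := by
  rintro _ ⟨x, y, h, rfl⟩
  rw [map_mul, map_inv, mul_inv_eq_one]
  cases h with
  | braid i j hi hj h =>
    simp only [map_mul, fσ, FreeGroup.lift_apply_of]
    exact rel_eq (GroupRel.braid (d := d) (n := n + 1) i j (by omega) (by omega) h)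
  | far i j hi hj h =>
    simp only [map_mul, fσ, FreeGroup.lift_apply_of]
    exact rel_eq (GroupRel.far (d := d) (n := n + 1) i j (by omega) (by omega) h)
  | framing_comm i j =>
    simp only [map_mul, ft, FreeGroup.lift_apply_of]
    exact rel_eq (GroupRel.framing_comm (d := d) (n := n + 1) i.castSucc j.castSucc)
  | framing_braid i hi j =>
    have := rel_eq (GroupRel.framing_braid (d := d) (n := n + 1) i (by omega) j.castSucc)
    rw [← castSucc_adjSwap n i hi] at this
    simp only [map_mul, ft, fσ, FreeGroup.lift_apply_of]
    exact this
  | modular j =>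
    simp only [map_pow, map_one, ft, FreeGroup.lift_apply_of]
    exact rel_eq (GroupRel.modular (d := d) (n := n + 1) j.castSucc)

/-- The natural map `F_{d,n} → F_{d,n+1}`. -/
def grpIncl (d n : ℕ) : FramedBraidGroup d n →* FramedBraidGroup d (n + 1) :=
  PresentedGroup.toGroup (genIncl_rel d n)

theorem grpIncl_σ (d n i : ℕ) (hi : i + 1 < n) :
    grpIncl d n (σ d n i hi) = σ d (n + 1) i (by omega) :=
  PresentedGroup.toGroup.of _

theorem grpIncl_t (d n : ℕ) (j : Fin n) :
    grpIncl d n (tGrp d n j) = tGrp d (n + 1) j.castSucc :=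
  PresentedGroup.toGroup.of _

/-- The natural map `ℂ F_{d,n} → ℂ F_{d,n+1}`. -/
def algIncl (d n : ℕ) : FramedBraidAlgebra d n →ₐ[ℂ] FramedBraidAlgebra d (n + 1) :=
  MonoidAlgebra.lift ℂ _ _ ((MonoidAlgebra.of ℂ (FramedBraidGroup d (n + 1))).comp (grpIncl d n))

theorem algIncl_of (d n : ℕ) (x : FramedBraidGroup d n) :
    algIncl d n (MonoidAlgebra.of ℂ _ x) = MonoidAlgebra.of ℂ _ (grpIncl d n x) := by
  simp [algIncl]

theorem algIncl_e (d n i : ℕ) (hi : i + 1 < n) :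
    algIncl d n (eGrp d n i hi) = eGrp d (n + 1) i (by omega) := by
  simp only [eGrp, map_smul, map_sum, algIncl_of, map_mul, map_pow, grpIncl_t]
  rfl

/-- The natural map `Y_{d,n}(q) → Y_{d,n+1}(q)`, given by `g_i ↦ g_i` and `t_j ↦ t_j`. -/
def incl (d n : ℕ) (q : ℂ) : Y d n q →ₐ[ℂ] Y d (n + 1) q :=
  RingQuot.liftAlgHom ℂ ⟨(proj d (n + 1) q).comp (algIncl d n), by
    rintro _ _ ⟨i, hi⟩
    have h := RingQuot.mkAlgHom_rel ℂ (QuadRel.quad (d := d) (n := n + 1) (q := q) i (by omega))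
    simp only [AlgHom.comp_apply, map_pow, map_add, map_one, map_smul, map_mul, algIncl_of,
      algIncl_e, grpIncl_σ]
    simp only [map_pow, map_add, map_one, map_smul, map_mul] at h
    exact h⟩

theorem incl_proj (d n : ℕ) (q : ℂ) (x : FramedBraidAlgebra d n) :
    incl d n q (proj d n q x) = proj d (n + 1) q (algIncl d n x) := by
  simp [incl, proj]

theorem incl_g (d n : ℕ) (q : ℂ) (i : ℕ) (hi : i + 1 < n) :
    incl d n q (g d n q i hi) = g d (n + 1) q i (by omega) := by
  rw [g, incl_proj, algIncl_of, grpIncl_σ, g]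

theorem incl_t (d n : ℕ) (q : ℂ) (j : Fin n) :
    incl d n q (t d n q j) = t d (n + 1) q j.castSucc := by
  rw [t, incl_proj, algIncl_of, grpIncl_t, t]

/-! ### The subalgebra generated by the braiding generators -/

/-- The subalgebra `Y_{d,n}(q)^{(br)}` of `Y_{d,n}(q)` generated by `g_1, …, g_{n-1}`. -/
def br (d n : ℕ) (q : ℂ) : Subalgebra ℂ (Y d n q) :=
  Algebra.adjoin ℂ {x | ∃ (i : ℕ) (hi : i + 1 < n), x = g d n q i hi}

theorem g_mem_br (d n : ℕ) (q : ℂ) (i : ℕ) (hi : i + 1 < n) : g d n q i hi ∈ br d n q :=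
  Algebra.subset_adjoin ⟨i, hi, rfl⟩

theorem incl_mem_br (d n : ℕ) (q : ℂ) (a : br d n q) :
    incl d n q (a : Y d n q) ∈ br d (n + 1) q := by
  have h : br d n q ≤ (br d (n + 1) q).comap (incl d n q) := by
    refine Algebra.adjoin_le ?_
    rintro _ ⟨i, hi, rfl⟩
    change incl d n q (g d n q i hi) ∈ br d (n + 1) q
    rw [incl_g]
    exact g_mem_br d (n + 1) q i (by omega)
  exact h a.2

/-- The natural map `Y_{d,n}(q)^{(br)} → Y_{d,n+1}(q)^{(br)}`. -/
def brIncl (d n : ℕ) (q : ℂ) (a : br d n q) : br d (n + 1) q :=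
  ⟨incl d n q a, incl_mem_br d n q a⟩

/-- The generator `g_i` as an element of `Y_{d,n}(q)^{(br)}`. -/
def brG (d n : ℕ) (q : ℂ) (i : ℕ) (hi : i + 1 < n) : br d n q :=
  ⟨g d n q i hi, g_mem_br d n q i hi⟩

/-! ### The traces

A linear map on `⋃_n Y_{d,n}(q)` is a family of linear maps on the `Y_{d,n}(q)` that is compatible
with the natural inclusions (and similarly for the subalgebras `Y_{d,n}(q)^{(br)}`). The
indeterminate `z` is `Polynomial.X : ℂ[X]`. -/

/-- The rules (i)--(v) for a family `τ` of linear maps `Y_{d,n}(q)^{(br)} → ℂ[z]`.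
In the last three rules `a` is in `Y_{d,n+1}(q)^{(br)}` and the index `n` of `g`, `e` denotes the
last generator of `Y_{d,n+2}(q)`. The last two rules make sense when `e_n` lies in
`Y_{d,n+2}(q)^{(br)}`, which is always the case when `q ≠ ±1`, see `e_mem_br`. -/
structure IsBraidTrace (d : ℕ) (q : ℂ) (m : ℕ) (τ : ∀ n : ℕ, br d n q →ₗ[ℂ] ℂ[X]) : Prop where
  compat : ∀ (n : ℕ) (a : br d n q), τ (n + 1) (brIncl d n q a) = τ n a
  trace : ∀ (n : ℕ) (a b : br d n q), τ n (a * b) = τ n (b * a)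
  one : ∀ n : ℕ, τ n 1 = 1
  markov : ∀ (n : ℕ) (a : br d (n + 1) q),
    τ (n + 2) (brIncl d (n + 1) q a * brG d (n + 2) q n (by omega)) =
      Polynomial.X * τ (n + 1) a
  idem : ∀ (n : ℕ) (a : br d (n + 1) q) (he : e d (n + 2) q n (by omega) ∈ br d (n + 2) q),
    τ (n + 2) (brIncl d (n + 1) q a * ⟨e d (n + 2) q n (by omega), he⟩) =
      Polynomial.C (1 / (m : ℂ)) * τ (n + 1) a
  idem_markov : ∀ (n : ℕ) (a : br d (n + 1) q)
    (he : e d (n + 2) q n (by omega) ∈ br d (n + 2) q),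
    τ (n + 2) (brIncl d (n + 1) q a * ⟨e d (n + 2) q n (by omega), he⟩ *
      brG d (n + 2) q n (by omega)) = Polynomial.X * τ (n + 1) a

/-- The solution `X_D = (x_1, …, x_{d-1})` of the E-system parametrized by a nonempty subset `D`
of `ℤ/dℤ`: `x_k = (1/|D|) ∑_{j ∈ D} exp(2π√-1 jk/d)`. -/
def xD (d : ℕ) (D : Finset (ZMod d)) (k : ℕ) : ℂ :=
  (1 / (D.card : ℂ)) *
    ∑ j ∈ D, Complex.exp (2 * Real.pi * Complex.I * (j.val : ℂ) * (k : ℂ) / (d : ℂ))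

/-- The defining rules (1), (2), (3), (4') of the specialized trace `tr_{d,D}` for a family `T` of
linear maps `Y_{d,n}(q) → ℂ[z]`. -/
structure IsSpecializedTrace (d : ℕ) (q : ℂ) (D : Finset (ZMod d))
    (T : ∀ n : ℕ, Y d n q →ₗ[ℂ] ℂ[X]) : Prop where
  compat : ∀ (n : ℕ) (a : Y d n q), T (n + 1) (incl d n q a) = T n a
  trace : ∀ (n : ℕ) (a b : Y d n q), T n (a * b) = T n (b * a)
  one : ∀ n : ℕ, T n 1 = 1
  markov : ∀ (n : ℕ) (a : Y d (n + 1) q),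
    T (n + 2) (incl d (n + 1) q a * g d (n + 2) q n (by omega)) = Polynomial.X * T (n + 1) a
  framing : ∀ (n : ℕ) (a : Y d n q) (k : ℕ), 1 ≤ k → k ≤ d - 1 →
    T (n + 1) (incl d n q a * t d (n + 1) q (Fin.last n) ^ k) =
      Polynomial.C (xD d D k) * T n a

/-! ### For `q ≠ ±1` the idempotents `e_i` lie in `Y_{d,n}(q)^{(br)}` -/

theorem t_pow (d n : ℕ) (q : ℂ) (j : Fin n) : t d n q j ^ d = 1 := by
  have h : tGrp d n j ^ d = 1 := rel_eq (GroupRel.modular (d := d) (n := n) j)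
  rw [t, ← map_pow, ← map_pow, h, map_one, map_one]

theorem t_comm (d n : ℕ) (q : ℂ) (i j : Fin n) : t d n q i * t d n q j = t d n q j * t d n q i := by
  have h : tGrp d n i * tGrp d n j = tGrp d n j * tGrp d n i :=
    rel_eq (GroupRel.framing_comm (d := d) (n := n) i j)
  rw [t, t, ← map_mul, ← map_mul, h, map_mul, map_mul]

theorem e_eq (d n : ℕ) (q : ℂ) (i : ℕ) (hi : i + 1 < n) :
    e d n q i hi = (1 / (d : ℂ)) • ∑ s ∈ Finset.range d,
      t d n q ⟨i, by omega⟩ ^ s * t d n q ⟨i + 1, hi⟩ ^ (d - s) := by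
  simp only [e, eGrp, t, map_smul, map_sum, map_mul, map_pow]

theorem g_sq (d n : ℕ) (q : ℂ) (i : ℕ) (hi : i + 1 < n) :
    g d n q i hi ^ 2 = 1 + (q - q⁻¹) • (e d n q i hi * g d n q i hi) := by
  have h := RingQuot.mkAlgHom_rel ℂ (QuadRel.quad (d := d) (n := n) (q := q) i hi)
  simp only [map_pow, map_add, map_one, map_smul, map_mul] at h
  exact h

theorem e_idem {d : ℕ} (hd : 1 ≤ d) (n : ℕ) (q : ℂ) (i : ℕ) (hi : i + 1 < n) :
    e d n q i hi * e d n q i hi = e d n q i hi := by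
  set x := t d n q ⟨i, by omega⟩ with hx
  set y := t d n q ⟨i + 1, hi⟩ with hy
  have hxy : Commute x y := t_comm d n q _ _
  have hxd : x ^ d = 1 := t_pow d n q _
  have hyd : y ^ d = 1 := t_pow d n q _
  have he : e d n q i hi = (1 / (d : ℂ)) • ∑ s ∈ Finset.range d, x ^ s * y ^ (d - s) :=
    e_eq d n q i hi
  have h1 : x * e d n q i hi = y * e d n q i hi := by
    rw [he, mul_smul_comm, mul_smul_comm, Finset.mul_sum, Finset.mul_sum]
    congr 1
    have a1 : ∀ s ∈ Finset.range d,
        x * (x ^ s * y ^ (d - s)) = x ^ (s + 1) * y ^ (d + 1 - (s + 1)) := by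
      intro s _
      rw [← mul_assoc, ← pow_succ', Nat.add_sub_add_right]
    have a2 : ∀ s ∈ Finset.range d, y * (x ^ s * y ^ (d - s)) = x ^ s * y ^ (d + 1 - s) := by
      intro s hs
      have hs' := Finset.mem_range.mp hs
      rw [← mul_assoc, (hxy.symm.pow_right s).eq, mul_assoc, ← pow_succ']
      congr 2
      omega
    rw [Finset.sum_congr rfl a1, Finset.sum_congr rfl a2]
    have b1 := Finset.sum_range_succ (fun s => x ^ s * y ^ (d + 1 - s)) d
    have b2 := Finset.sum_range_succ' (fun s => x ^ s * y ^ (d + 1 - s)) d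
    have b3 : x ^ d * y ^ (d + 1 - d) = x ^ 0 * y ^ (d + 1 - 0) := by
      rw [hxd, pow_zero, Nat.sub_zero, pow_succ y d, hyd, Nat.add_sub_cancel_left, pow_one, one_mul, one_mul]
    rw [b1, b3] at b2
    exact (add_right_cancel b2).symm
  have h2 : ∀ s : ℕ, x ^ s * e d n q i hi = y ^ s * e d n q i hi := by
    intro s
    induction s with
    | zero => simp
    | succ s ih =>
      rw [pow_succ', mul_assoc, ih, ← mul_assoc, (hxy.pow_right s).eq, mul_assoc, h1, ← mul_assoc,
        ← pow_succ]
  conv_lhs => enter [1]; rw [he]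
  rw [smul_mul_assoc, Finset.sum_mul]
  have h3 : ∀ s ∈ Finset.range d, x ^ s * y ^ (d - s) * e d n q i hi = e d n q i hi := by
    intro s hs
    have hs' := Finset.mem_range.mp hs
    rw [(hxy.pow_pow s (d - s)).eq, mul_assoc, h2, ← mul_assoc, ← pow_add,
      Nat.sub_add_cancel hs'.le, hyd, one_mul]
  rw [Finset.sum_congr rfl h3, Finset.sum_const, Finset.card_range, ← Nat.cast_smul_eq_nsmul ℂ,
    smul_smul, one_div_mul_cancel (by exact_mod_cast (by omega : d ≠ 0)), one_smul]

theorem e_mem_br {d : ℕ} (hd : 1 ≤ d) (n : ℕ) {q : ℂ} (hq : q ≠ 0) (h1 : q ≠ 1) (h2 : q ≠ -1)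
    (i : ℕ) (hi : i + 1 < n) : e d n q i hi ∈ br d n q := by
  have hc : q - q⁻¹ ≠ 0 := by
    intro h
    have h3 : (q - 1) * (q + 1) = 0 := by
      field_simp at h
      linear_combination h
    rcases mul_eq_zero.mp h3 with h4 | h4
    · exact h1 (sub_eq_zero.mp h4)
    · exact h2 (eq_neg_of_add_eq_zero_left h4)
  have hg := g_mem_br d n q i hi
  have hsq := g_sq d n q i hi
  have hh : e d n q i hi * g d n q i hi = (q - q⁻¹)⁻¹ • (g d n q i hi ^ 2 - 1) := by
    rw [hsq, add_sub_cancel_left, smul_smul, inv_mul_cancel₀ hc, one_smul]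
  have hmem : e d n q i hi * g d n q i hi ∈ br d n q := by
    rw [hh]
    exact Subalgebra.smul_mem _ (sub_mem (pow_mem hg 2) (one_mem _)) _
  have he : e d n q i hi = e d n q i hi * g d n q i hi * g d n q i hi -
      (q - q⁻¹) • (e d n q i hi * g d n q i hi) := by
    rw [mul_assoc, ← pow_two, hsq, mul_add, mul_one, mul_smul_comm, ← mul_assoc, e_idem hd,
      add_sub_cancel_right]
  rw [he]
  exact sub_mem (mul_mem hmem hg) (Subalgebra.smul_mem _ hmem _)

end YokonumaHecke

end

/-!
The rules for both traces reduce the computation of a trace to fewer strands, so uniqueness follows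
from two spanning results and existence is the real content.

*Spanning.* `Y_{d,n+1}(q)` is spanned by the elements `a t_{n+1}^k` and `a g_n b` with `a`, `b` in
`Y_{d,n}(q)` (`mem_genYSpan`, proved over any coefficient ring). Hence the values of a Markov trace
lie in every submodule containing its value at `1` (`IsMarkovFunction.mem_of_one_mem`). Applied to a
difference of two traces and the zero submodule this gives uniqueness; applied to a trace with
values in a large ring of functions it shows that the values are polynomials in the parameters.
Likewise `Y_{d,n+1}(q)^{(br)}` is spanned by `a` and `a x b` with `a`, `b` one level below and `x`
one of `g_n`, `(q - q⁻¹) e_n`, `(q - q⁻¹) e_n g_n` (`mem_brSpan`). The scaling by `q - q⁻¹` keeps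
the letters inside the subalgebra even when `q = ±1`, so that this case needs no separate treatment
of the spanning.

*Existence.* Put `V = ℂ^{D × N}`, where `t` acts on the vectors of colour `j ∈ D` through the `j`-th
character, and let `g` act on `V ⊗ V` by the Hecke R-matrix on pairs of vectors of equal colour and
by the flip otherwise. This defines a representation of the framed braid group on `V^{⊗n}` that
factors through `Y_{d,n}(q)`. Its trace, weighted by `μ^{⊗n}` where `μ` is proportional to `q^{-2i}`
on the `i`-th level, satisfies the trace rule since weights are preserved, and the Markov and
framing rules by a partial trace over the last factor (`isMarkovFunction_wtr`). Normalizing `μ` to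
have sum `1 / |D|` on each colour produces `x_D`, and the Markov parameter is `q / (|D| (1 + q⁻² + ⋯
+ q^{-2(N-1)}))`. Only special values of `z` arise in this way, but the values are polynomials in
`(q - q⁻¹) / d` and `z` by the spanning result, and such polynomials are determined by the
parameters with `q = 2, 3, …` and all `N` (`eq_zero_of_evalEval`). So the identities hold for
indeterminate parameters, and may be specialized to any `q` (`exists_markovFunction`).

*Restriction.* For the specialized trace, `tr(a e_n) = tr(a) / |D|` is a consequence of the
orthogonality of characters, which is immediate for the R-matrix traces (`wtr_idem`) and is carried
along the interpolation, and `tr(a e_n g_n) = z tr(a)` holds because `e_n g_n` is the average of the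
conjugates `t_n^s g_n t_n^{-s}`. So the restriction satisfies all the rules for `tr_{d,m}`.
-/

open scoped Polynomial

noncomputable section

namespace YokonumaHecke

/-! ### Linear maps on quotients of group algebras -/

section General

variable {R : Type*} [CommRing R] {M : Type*} [AddCommGroup M] [Module R M]

/-- The linear extension to the group algebra of a function on the group. -/
def linExt (R : Type*) [CommRing R] [Module R M] {G : Type*} [Group G] (f : G → M) :
    MonoidAlgebra R G →ₗ[R] M :=
  (Finsupp.linearCombination R f).comp (MonoidAlgebra.coeffLinearEquiv R).toLinearMap

theorem linExt_of {G : Type*} [Group G] (f : G → M) (x : G) :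
    linExt R f (MonoidAlgebra.of R G x) = f x := by
  simp [linExt]

/-- A linear map that respects a relation after multiplication on both sides descends to the
quotient by the two-sided ideal generated by the relation. -/
theorem exists_linear_lift {B : Type*} [Ring B] [Algebra R B] (r : B → B → Prop) (f : B →ₗ[R] M)
    (h : ∀ x y, r x y → ∀ u v, f (u * x * v) = f (u * y * v)) :
    ∃ f' : RingQuot r →ₗ[R] M, ∀ b, f' (RingQuot.mkAlgHom R r b) = f b := by
  have key : ∀ x y, RingQuot.Rel r x y → ∀ u v, f (u * x * v) = f (u * y * v) := by
    intro x y hxy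
    induction hxy with
    | of hxy => exact h _ _ hxy
    | add_left _ ih => intro u v; simp only [mul_add, add_mul, map_add, ih]
    | @mul_left a b c _ ih =>
      intro u v
      simpa only [mul_assoc] using ih u (c * v)
    | @mul_right a b c _ ih =>
      intro u v
      simpa only [mul_assoc] using ih (u * a) v
  have ker : ∀ b, RingQuot.mkAlgHom R r b = 0 → f b = 0 := by
    intro b hb
    have h1 : RingQuot.mkRingHom r b = RingQuot.mkRingHom r 0 := by
      rw [map_zero, ← hb, ← RingQuot.mkAlgHom_coe R]; rfl
    simp only [RingQuot.mkRingHom_def] at h1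
    have h2 : Quot.mk (RingQuot.Rel r) b = Quot.mk (RingQuot.Rel r) 0 :=
      congrArg RingQuot.toQuot h1
    have h3 := Quot.eqvGen_exact h2
    have h4 : ∀ x y, Relation.EqvGen (RingQuot.Rel r) x y → f x = f y := by
      intro x y hxy
      induction hxy with
      | rel x y hxy => simpa using key x y hxy 1 1
      | refl x => rfl
      | symm x y _ ih => exact ih.symm
      | trans x y z _ _ ih1 ih2 => exact ih1.trans ih2
    rw [h4 _ _ h3, map_zero]
  choose s hs using RingQuot.mkAlgHom_surjective R r
  have fs : ∀ b, f (s (RingQuot.mkAlgHom R r b)) = f b := by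
    intro b
    rw [← sub_eq_zero, ← map_sub]
    exact ker _ (by rw [map_sub, hs, sub_self])
  refine ⟨{ toFun := fun y => f (s y), map_add' := ?_, map_smul' := ?_ }, fs⟩
  · intro x y
    obtain ⟨a, rfl⟩ := RingQuot.mkAlgHom_surjective R r x
    obtain ⟨b, rfl⟩ := RingQuot.mkAlgHom_surjective R r y
    rw [← map_add, fs, fs, fs, map_add]
  · intro k x
    obtain ⟨a, rfl⟩ := RingQuot.mkAlgHom_surjective R r x
    rw [← map_smul, fs, fs, map_smul, RingHom.id_apply]

end General

/-! ### Relations in the framed braid group -/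

theorem framedBraid_induction {d n : ℕ} (H : Subgroup (FramedBraidGroup d n))
    (hσ : ∀ i hi, σ d n i hi ∈ H) (ht : ∀ j, tGrp d n j ∈ H) (x : FramedBraidGroup d n) :
    x ∈ H :=
  PresentedGroup.generated_by _ H (fun j => by cases j with
    | sigma i hi => exact hσ i hi
    | framing j => exact ht j) x

theorem σ_braid (d n i : ℕ) (hi : i + 2 < n) :
    σ d n (i + 1) hi * σ d n i (by omega) * σ d n (i + 1) hi =
      σ d n i (by omega) * σ d n (i + 1) hi * σ d n i (by omega) :=
  rel_eq (GroupRel.braid (d := d) (i + 1) i hi (by omega) (Or.inl rfl))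

theorem σ_far (d n i j : ℕ) (hi : i + 1 < n) (hj : j + 1 < n) (h : j + 1 < i) :
    Commute (σ d n i hi) (σ d n j hj) :=
  rel_eq (GroupRel.far (d := d) i j hi hj (Or.inl h))

theorem tGrp_comm (d n : ℕ) (i j : Fin n) : Commute (tGrp d n i) (tGrp d n j) :=
  rel_eq (GroupRel.framing_comm (d := d) i j)

theorem tGrp_mul_σ (d n i : ℕ) (hi : i + 1 < n) (j : Fin n) :
    tGrp d n j * σ d n i hi = σ d n i hi * tGrp d n (adjSwap n i hi j) :=
  rel_eq (GroupRel.framing_braid (d := d) i hi j)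

theorem tGrp_pow (d n : ℕ) (j : Fin n) : tGrp d n j ^ d = 1 :=
  rel_eq (GroupRel.modular (d := d) j)

theorem adjSwap_left (n i : ℕ) (hi : i + 1 < n) :
    adjSwap n i hi ⟨i, by omega⟩ = ⟨i + 1, hi⟩ := Equiv.swap_apply_left _ _

theorem adjSwap_right (n i : ℕ) (hi : i + 1 < n) :
    adjSwap n i hi ⟨i + 1, hi⟩ = ⟨i, by omega⟩ := Equiv.swap_apply_right _ _

theorem adjSwap_of_ne (n i : ℕ) (hi : i + 1 < n) (j : Fin n) (h1 : (j : ℕ) ≠ i)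
    (h2 : (j : ℕ) ≠ i + 1) : adjSwap n i hi j = j :=
  Equiv.swap_apply_of_ne_of_ne (fun h => h1 (congrArg Fin.val h)) (fun h => h2 (congrArg Fin.val h))

theorem tGrp_last_commute (d n : ℕ) (x : FramedBraidGroup d n) :
    Commute (tGrp d (n + 1) (Fin.last n)) (grpIncl d n x) := by
  refine (Subgroup.mem_centralizer_singleton_iff (g := tGrp d (n + 1) (Fin.last n))).1
    (framedBraid_induction ((Subgroup.centralizer {tGrp d (n + 1) (Fin.last n)}).comap
      (grpIncl d n)) ?_ ?_ x) |>.symm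
  · intro i hi
    rw [Subgroup.mem_comap, Subgroup.mem_centralizer_singleton_iff, grpIncl_σ, tGrp_mul_σ,
      adjSwap_of_ne]
    · simp only [Fin.val_last]; omega
    · simp only [Fin.val_last]; omega
  · intro j
    rw [Subgroup.mem_comap, Subgroup.mem_centralizer_singleton_iff, grpIncl_t]
    exact (tGrp_comm _ _ _ _)

theorem σ_last_commute (d n : ℕ) (x : FramedBraidGroup d n) :
    Commute (σ d (n + 2) n (by omega)) (grpIncl d (n + 1) (grpIncl d n x)) := by
  refine (Subgroup.mem_centralizer_singleton_iff (g := σ d (n + 2) n (by omega))).1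
    (framedBraid_induction ((Subgroup.centralizer {σ d (n + 2) n (by omega)}).comap
      ((grpIncl d (n + 1)).comp (grpIncl d n))) ?_ ?_ x) |>.symm
  · intro i hi
    rw [Subgroup.mem_comap, Subgroup.mem_centralizer_singleton_iff, MonoidHom.comp_apply,
      grpIncl_σ, grpIncl_σ]
    exact (σ_far d (n + 2) n i _ _ hi).symm
  · intro j
    rw [Subgroup.mem_comap, Subgroup.mem_centralizer_singleton_iff, MonoidHom.comp_apply,
      grpIncl_t, grpIncl_t, tGrp_mul_σ, adjSwap_of_ne]
    · simp only [Fin.val_castSucc]; omega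
    · simp only [Fin.val_castSucc]; omega

/-! ### The Yokonuma--Hecke algebra over a commutative ring -/

section Generic

variable {R : Type*} [CommRing R]

/-- The quadratic relation `σ_i² = 1 + κ (∑_s t_i^s t_{i+1}^{d-s}) σ_i` over a commutative ring.
For `κ = (q - q⁻¹) / d` this is the relation of `Y_{d,n}(q)`; no invertibility of `d` or of a
parameter `q` is needed. -/
inductive GenRel (d n : ℕ) (κ : R) : MonoidAlgebra R (FramedBraidGroup d n) →
    MonoidAlgebra R (FramedBraidGroup d n) → Prop
  | quad (i : ℕ) (hi : i + 1 < n) :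
      GenRel d n κ
        (MonoidAlgebra.of R (FramedBraidGroup d n) (σ d n i hi * σ d n i hi))
        (1 + κ • ∑ s ∈ Finset.range d, MonoidAlgebra.of R (FramedBraidGroup d n)
          (tGrp d n ⟨i, by omega⟩ ^ s * tGrp d n ⟨i + 1, hi⟩ ^ (d - s) * σ d n i hi))

/-- The Yokonuma--Hecke algebra over a commutative ring `R` with parameter `κ`. -/
abbrev GenY (d n : ℕ) (κ : R) : Type _ := RingQuot (GenRel d n κ)

/-- The image of an element of the framed braid group in `GenY d n κ`. -/
def toGenY (d n : ℕ) (κ : R) : FramedBraidGroup d n →* GenY d n κ :=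
  (RingQuot.mkAlgHom R (GenRel d n κ)).toMonoidHom.comp (MonoidAlgebra.of R _)

theorem toGenY_quad (d n : ℕ) (κ : R) (i : ℕ) (hi : i + 1 < n) :
    toGenY d n κ (σ d n i hi) * toGenY d n κ (σ d n i hi) =
      1 + κ • ∑ s ∈ Finset.range d, toGenY d n κ (tGrp d n ⟨i, by omega⟩ ^ s *
        tGrp d n ⟨i + 1, hi⟩ ^ (d - s) * σ d n i hi) := by
  have h := RingQuot.mkAlgHom_rel R (GenRel.quad (κ := κ) (d := d) (n := n) i hi)
  simp only [map_add, map_one, map_smul, map_sum] at h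
  rw [← map_mul]
  exact h

theorem genY_induction {d n : ℕ} {κ : R} {p : GenY d n κ → Prop}
    (of : ∀ x, p (toGenY d n κ x)) (add : ∀ a b, p a → p b → p (a + b))
    (smul : ∀ (k : R) a, p a → p (k • a)) (a : GenY d n κ) : p a := by
  obtain ⟨b, rfl⟩ := RingQuot.mkAlgHom_surjective R (GenRel d n κ) a
  induction b using MonoidAlgebra.induction_on with
  | of x => exact of _
  | add x y hx hy => rw [map_add]; exact add _ _ hx hy
  | smul k x hx => rw [map_smul]; exact smul _ _ hx

/-- A submodule of `GenY d n κ` that contains `1` and is stable under left multiplication by the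
generators is everything. -/
theorem genY_submodule_eq_top {d n : ℕ} (hd : 1 ≤ d) {κ : R}
    (U : Submodule R (GenY d n κ)) (h1 : 1 ∈ U)
    (hσ : ∀ i hi, ∀ u ∈ U, toGenY d n κ (σ d n i hi) * u ∈ U)
    (ht : ∀ j, ∀ u ∈ U, toGenY d n κ (tGrp d n j) * u ∈ U) (a : GenY d n κ) : a ∈ U := by
  have htp : ∀ j (k : ℕ), ∀ u ∈ U, toGenY d n κ (tGrp d n j ^ k) * u ∈ U := by
    intro j k
    induction k with
    | zero => intro u hu; simpa using hu
    | succ k ih =>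
      intro u hu
      rw [pow_succ, map_mul, mul_assoc]
      exact ih _ (ht j u hu)
  let H : Subgroup (FramedBraidGroup d n) :=
    { carrier := {x | (∀ u ∈ U, toGenY d n κ x * u ∈ U) ∧ ∀ u ∈ U, toGenY d n κ x⁻¹ * u ∈ U}
      mul_mem' := by
        rintro x y ⟨hx, hx'⟩ ⟨hy, hy'⟩
        refine ⟨fun u hu => ?_, fun u hu => ?_⟩
        · rw [map_mul, mul_assoc]; exact hx _ (hy _ hu)
        · rw [mul_inv_rev, map_mul, mul_assoc]; exact hy' _ (hx' _ hu)
      one_mem' := by simp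
      inv_mem' := by
        rintro x ⟨hx, hx'⟩
        exact ⟨hx', by simpa using hx⟩ }
  have hH : ∀ x, x ∈ H := by
    intro x
    refine framedBraid_induction H ?_ ?_ x
    · intro i hi
      refine ⟨hσ i hi, fun u hu => ?_⟩
      -- the quadratic relation, multiplied by `σ⁻¹`, expresses `σ⁻¹` through the generators
      have hq := congrArg (fun y => y * toGenY d n κ (σ d n i hi)⁻¹) (toGenY_quad d n κ i hi)
      simp only [add_mul, smul_mul_assoc, Finset.sum_mul, ← map_mul, mul_inv_cancel_right,
        one_mul] at hq
      rw [← sub_eq_iff_eq_add] at hq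
      rw [← hq, sub_mul, smul_mul_assoc, Finset.sum_mul]
      refine sub_mem (hσ i hi u hu) (U.smul_mem _ (sum_mem fun s _ => ?_))
      rw [map_mul, mul_assoc]
      exact htp _ _ _ (htp _ _ _ hu)
    · intro j
      refine ⟨ht j, fun u hu => ?_⟩
      have : (tGrp d n j)⁻¹ = tGrp d n j ^ (d - 1) := by
        rw [inv_eq_iff_mul_eq_one, ← pow_succ', Nat.sub_add_cancel hd, tGrp_pow]
      rw [this]
      exact htp _ _ _ hu
  refine genY_induction (p := (· ∈ U)) (fun x => ?_) (fun _ _ => add_mem)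
    (fun k _ => U.smul_mem k) a
  simpa using (hH x).1 1 h1

/-- The natural map `GenY d n κ → GenY d (n + 1) κ`. -/
def genYIncl (d n : ℕ) (κ : R) : GenY d n κ →ₐ[R] GenY d (n + 1) κ :=
  RingQuot.liftAlgHom R ⟨MonoidAlgebra.lift R _ _ ((toGenY d (n + 1) κ).comp (grpIncl d n)), by
    rintro _ _ ⟨i, hi⟩
    simp only [map_add, map_one, map_smul, map_sum, MonoidAlgebra.lift_of, MonoidHom.comp_apply,
      map_mul (grpIncl d n), map_pow (grpIncl d n), grpIncl_σ, grpIncl_t]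
    rw [map_mul, toGenY_quad]
    rfl⟩

theorem genYIncl_toGenY (d n : ℕ) (κ : R) (x : FramedBraidGroup d n) :
    genYIncl d n κ (toGenY d n κ x) = toGenY d (n + 1) κ (grpIncl d n x) := by
  change genYIncl d n κ (RingQuot.mkAlgHom R (GenRel d n κ) (MonoidAlgebra.of R _ x)) = _
  rw [genYIncl, RingQuot.liftAlgHom_mkAlgHom_apply, MonoidAlgebra.lift_of]
  rfl

theorem genY_commute_t (d n : ℕ) (κ : R) (a : GenY d n κ) (k : ℕ) :
    Commute (toGenY d (n + 1) κ (tGrp d (n + 1) (Fin.last n) ^ k)) (genYIncl d n κ a) := by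
  induction a using genY_induction with
  | of x => rw [genYIncl_toGenY]; exact ((tGrp_last_commute d n x).pow_left k).map _
  | add a b ha hb => rw [map_add]; exact ha.add_right hb
  | smul r a ha => rw [map_smul]; exact ha.smul_right r

theorem genY_commute_σ (d n : ℕ) (κ : R) (a : GenY d n κ) :
    Commute (toGenY d (n + 2) κ (σ d (n + 2) n (by omega)))
      (genYIncl d (n + 1) κ (genYIncl d n κ a)) := by
  induction a using genY_induction with
  | of x => rw [genYIncl_toGenY, genYIncl_toGenY]; exact (σ_last_commute d n x).map _
  | add a b ha hb => rw [map_add, map_add]; exact ha.add_right hb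
  | smul r a ha => rw [map_smul, map_smul]; exact ha.smul_right r

/-- The span of the elements `a t_n^k` and `a σ_{n-1} b` of `GenY d (n + 1) κ`, where `a` and `b`
come from `GenY d n κ`. -/
def genYSpan (d n : ℕ) (κ : R) : Submodule R (GenY d (n + 1) κ) :=
  Submodule.span R ({y | ∃ a k, y = genYIncl d n κ a *
      toGenY d (n + 1) κ (tGrp d (n + 1) (Fin.last n) ^ k)} ∪
    {y | ∃ a b, ∃ (i : ℕ) (hi : i + 1 = n), y = genYIncl d n κ a *
      toGenY d (n + 1) κ (σ d (n + 1) i (by omega)) * genYIncl d n κ b})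

theorem mem_genYSpan_t {d n : ℕ} {κ : R} (a : GenY d n κ) (k : ℕ) :
    genYIncl d n κ a * toGenY d (n + 1) κ (tGrp d (n + 1) (Fin.last n) ^ k) ∈ genYSpan d n κ :=
  Submodule.subset_span (Or.inl ⟨a, k, rfl⟩)

theorem mem_genYSpan_σ {d n : ℕ} {κ : R} (a b : GenY d n κ) (i : ℕ) (hi : i + 1 = n) :
    genYIncl d n κ a * toGenY d (n + 1) κ (σ d (n + 1) i (by omega)) * genYIncl d n κ b ∈
      genYSpan d n κ :=
  Submodule.subset_span (Or.inr ⟨a, b, i, hi, rfl⟩)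

theorem incl_mul_mem_genYSpan {d n : ℕ} {κ : R} (c : GenY d n κ) {u : GenY d (n + 1) κ}
    (hu : u ∈ genYSpan d n κ) : genYIncl d n κ c * u ∈ genYSpan d n κ := by
  induction hu using Submodule.span_induction with
  | mem y hy =>
    rcases hy with ⟨a, k, rfl⟩ | ⟨a, b, i, hi, rfl⟩
    · rw [← mul_assoc, ← map_mul]; exact mem_genYSpan_t _ _
    · rw [← mul_assoc, ← mul_assoc, ← map_mul]; exact mem_genYSpan_σ _ _ _ hi
  | zero => simp
  | add x y _ _ hx hy => rw [mul_add]; exact add_mem hx hy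
  | smul k x _ hx => rw [mul_smul_comm]; exact Submodule.smul_mem _ _ hx

theorem mul_incl_mem_genYSpan {d n : ℕ} {κ : R} (c : GenY d n κ) {u : GenY d (n + 1) κ}
    (hu : u ∈ genYSpan d n κ) : u * genYIncl d n κ c ∈ genYSpan d n κ := by
  induction hu using Submodule.span_induction with
  | mem y hy =>
    rcases hy with ⟨a, k, rfl⟩ | ⟨a, b, i, hi, rfl⟩
    · rw [mul_assoc, (genY_commute_t d n κ c k).eq, ← mul_assoc, ← map_mul]
      exact mem_genYSpan_t _ _
    · rw [mul_assoc, ← map_mul]; exact mem_genYSpan_σ _ _ _ hi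
  | zero => simp
  | add x y _ _ hx hy => rw [add_mul]; exact add_mem hx hy
  | smul k x _ hx => rw [smul_mul_assoc]; exact Submodule.smul_mem _ _ hx

theorem tGrp_pow_mul_σ (d n i : ℕ) (hi : i + 1 < n) (j : Fin n) (k : ℕ) :
    tGrp d n j ^ k * σ d n i hi = σ d n i hi * tGrp d n (adjSwap n i hi j) ^ k := by
  induction k with
  | zero => simp
  | succ k ih => rw [pow_succ, mul_assoc, tGrp_mul_σ, ← mul_assoc, ih, mul_assoc, ← pow_succ]

/-- The inductive step of the spanning theorem: `σ_n a σ_n` is in the span for `a` in the span one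
level below. -/
theorem σ_mul_mul_σ_mem {d n : ℕ} {κ : R} {a : GenY d (n + 1) κ} (ha : a ∈ genYSpan d n κ) :
    toGenY d (n + 2) κ (σ d (n + 2) n (by omega)) * genYIncl d (n + 1) κ a *
      toGenY d (n + 2) κ (σ d (n + 2) n (by omega)) ∈ genYSpan d (n + 1) κ := by
  induction ha using Submodule.span_induction with
  | mem y hy =>
    rcases hy with ⟨a, k, rfl⟩ | ⟨a, b, i, rfl, rfl⟩
    · rw [map_mul, ← mul_assoc, (genY_commute_σ d n κ a).eq, mul_assoc, mul_assoc]
      refine incl_mul_mem_genYSpan _ ?_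
      rw [genYIncl_toGenY, map_pow, grpIncl_t, ← mul_assoc, ← map_mul]
      have h1 : σ d (n + 2) n (by omega) * tGrp d (n + 2) (Fin.last n).castSucc ^ k =
          tGrp d (n + 2) (Fin.last (n + 1)) ^ k * σ d (n + 2) n (by omega) := by
        rw [tGrp_pow_mul_σ]
        congr 3
        exact (adjSwap_right (n + 2) n (by omega)).symm
      rw [h1, map_mul, mul_assoc, toGenY_quad, mul_add, mul_one, mul_smul_comm, Finset.mul_sum]
      refine add_mem ?_ (Submodule.smul_mem _ _ (sum_mem fun s _ => ?_))
      · simpa using mem_genYSpan_t (d := d) (κ := κ) (1 : GenY d (n + 1) κ) k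
      · have h2 : tGrp d (n + 2) (Fin.last (n + 1)) ^ k *
            (tGrp d (n + 2) ⟨n, by omega⟩ ^ s * tGrp d (n + 2) ⟨n + 1, by omega⟩ ^ (d - s) *
              σ d (n + 2) n (by omega)) =
            grpIncl d (n + 1) (tGrp d (n + 1) (Fin.last n) ^ s) * σ d (n + 2) n (by omega) *
              grpIncl d (n + 1) (tGrp d (n + 1) (Fin.last n) ^ (k + (d - s))) := by
          rw [map_pow, map_pow, grpIncl_t, ← mul_assoc, ← mul_assoc,
            ((tGrp_comm d (n + 2) _ _).pow_pow k s).eq, mul_assoc _ (_ ^ k), mul_assoc (_ ^ s),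
            mul_assoc (_ ^ s)]
          change tGrp d (n + 2) (Fin.last n).castSucc ^ s *
            (tGrp d (n + 2) ⟨n + 1, by omega⟩ ^ k * tGrp d (n + 2) ⟨n + 1, by omega⟩ ^ (d - s) * _)
            = _
          rw [← pow_add, tGrp_pow_mul_σ, adjSwap_right]
          rfl
        rw [← map_mul, h2, map_mul, map_mul, ← genYIncl_toGenY, ← genYIncl_toGenY]
        exact mem_genYSpan_σ _ _ _ rfl
    · have h3 := congrArg (toGenY d (i + 1 + 2) κ) (σ_braid d (i + 1 + 2) i (by omega))
      simp only [map_mul] at h3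
      have hc1 := genY_commute_σ d (i + 1) κ a
      have hc2 := genY_commute_σ d (i + 1) κ b
      rw [map_mul, map_mul, genYIncl_toGenY, grpIncl_σ]
      have : toGenY d (i + 1 + 2) κ (σ d (i + 1 + 2) (i + 1) (by omega)) *
          (genYIncl d (i + 1 + 1) κ (genYIncl d (i + 1) κ a) *
            toGenY d (i + 1 + 2) κ (σ d (i + 1 + 2) i (by omega)) *
            genYIncl d (i + 1 + 1) κ (genYIncl d (i + 1) κ b)) *
          toGenY d (i + 1 + 2) κ (σ d (i + 1 + 2) (i + 1) (by omega)) =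
          genYIncl d (i + 1 + 1) κ (genYIncl d (i + 1) κ a) *
          (toGenY d (i + 1 + 2) κ (σ d (i + 1 + 2) (i + 1) (by omega)) *
            toGenY d (i + 1 + 2) κ (σ d (i + 1 + 2) i (by omega)) *
          toGenY d (i + 1 + 2) κ (σ d (i + 1 + 2) (i + 1) (by omega))) *
            genYIncl d (i + 1 + 1) κ (genYIncl d (i + 1) κ b) := by
        simp only [← mul_assoc]
        rw [hc1.eq]
        simp only [mul_assoc]
        rw [hc2.eq]
      rw [this, h3]
      refine mul_incl_mem_genYSpan _ (incl_mul_mem_genYSpan _ ?_)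
      have h4 := mem_genYSpan_σ (d := d) (κ := κ)
        (toGenY d (i + 1 + 1) κ (σ d (i + 1 + 1) i (by omega)))
        (toGenY d (i + 1 + 1) κ (σ d (i + 1 + 1) i (by omega))) (i + 1) rfl
      rwa [genYIncl_toGenY, grpIncl_σ] at h4
  | zero => simp
  | add x y _ _ hx hy => rw [map_add, mul_add, add_mul]; exact add_mem hx hy
  | smul k x _ hx =>
    rw [map_smul, mul_smul_comm, smul_mul_assoc]; exact Submodule.smul_mem _ _ hx

/-- The span of the words `a t_n^k` and `a σ_{n-1} b` is everything, provided that it contains the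
words with two occurrences of the last braiding generator. -/
theorem genYSpan_eq_top_of {d n : ℕ} (hd : 1 ≤ d) {κ : R}
    (h : ∀ (i : ℕ) (hi : i + 1 = n) (a : GenY d n κ),
      toGenY d (n + 1) κ (σ d (n + 1) i (by omega)) * genYIncl d n κ a *
        toGenY d (n + 1) κ (σ d (n + 1) i (by omega)) ∈ genYSpan d n κ)
    (u : GenY d (n + 1) κ) : u ∈ genYSpan d n κ := by
  refine genY_submodule_eq_top hd _ (by simpa using mem_genYSpan_t (d := d) (n := n) (κ := κ) 1 0)
    ?_ ?_ u
  · intro i hi u hu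
    by_cases hin : i + 1 < n
    · have := incl_mul_mem_genYSpan (toGenY d n κ (σ d n i hin)) hu
      rwa [genYIncl_toGenY, grpIncl_σ] at this
    obtain rfl : n = i + 1 := by omega
    induction hu using Submodule.span_induction with
    | mem y hy =>
      rcases hy with ⟨a, k, rfl⟩ | ⟨a, b, i', hi', rfl⟩
      · rw [← (genY_commute_t d (i + 1) κ a k).eq, ← mul_assoc, ← map_mul]
        have h1 : σ d (i + 1 + 1) i hi * tGrp d (i + 1 + 1) (Fin.last (i + 1)) ^ k =
            grpIncl d (i + 1) (tGrp d (i + 1) (Fin.last i) ^ k) * σ d (i + 1 + 1) i hi := by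
          rw [map_pow, grpIncl_t, tGrp_pow_mul_σ]
          congr 3
          exact (adjSwap_left (i + 2) i (by omega)).symm
        rw [h1, map_mul, ← genYIncl_toGenY]
        exact mem_genYSpan_σ _ _ i rfl
      · obtain rfl : i' = i := by omega
        rw [← mul_assoc, ← mul_assoc]
        exact mul_incl_mem_genYSpan _ (h i' rfl a)
    | zero => simp
    | add x y _ _ hx hy => rw [mul_add]; exact add_mem hx hy
    | smul k x _ hx => rw [mul_smul_comm]; exact Submodule.smul_mem _ _ hx
  · intro j u hu
    induction j using Fin.lastCases with
    | cast j =>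
      rw [← grpIncl_t, ← genYIncl_toGenY]
      exact incl_mul_mem_genYSpan _ hu
    | last =>
    induction hu using Submodule.span_induction with
    | mem y hy =>
      have hc : ∀ a, toGenY d (n + 1) κ (tGrp d (n + 1) (Fin.last n)) * genYIncl d n κ a =
          genYIncl d n κ a * toGenY d (n + 1) κ (tGrp d (n + 1) (Fin.last n)) := by
        intro a
        simpa using (genY_commute_t d n κ a 1).eq
      rcases hy with ⟨a, k, rfl⟩ | ⟨a, b, i, rfl, rfl⟩
      · rw [← mul_assoc, hc, mul_assoc, ← map_mul, ← pow_succ']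
        exact mem_genYSpan_t _ _
      · rw [← mul_assoc, ← mul_assoc, hc, mul_assoc _ _ (toGenY _ _ _ (σ _ _ _ _)), ← map_mul]
        have h1 : tGrp d (i + 1 + 1) (Fin.last (i + 1)) * σ d (i + 1 + 1) i (by omega) =
            σ d (i + 1 + 1) i (by omega) * grpIncl d (i + 1) (tGrp d (i + 1) (Fin.last i)) := by
          rw [grpIncl_t, tGrp_mul_σ]
          congr 2
          exact adjSwap_right (i + 2) i (by omega)
        rw [h1, map_mul, ← genYIncl_toGenY, ← mul_assoc, mul_assoc, ← map_mul]
        exact mem_genYSpan_σ _ _ i rfl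
    | zero => simp
    | add x y _ _ hx hy => rw [mul_add]; exact add_mem hx hy
    | smul k x _ hx => rw [mul_smul_comm]; exact Submodule.smul_mem _ _ hx

/-- `GenY d (n + 1) κ` is spanned by the elements `a t_n^k` and `a σ_{n-1} b` with `a` and `b`
from `GenY d n κ`. -/
theorem mem_genYSpan {d n : ℕ} (hd : 1 ≤ d) {κ : R} (a : GenY d (n + 1) κ) :
    a ∈ genYSpan d n κ := by
  induction n with
  | zero => exact genYSpan_eq_top_of hd (fun i hi => by omega) a
  | succ n ih =>
    refine genYSpan_eq_top_of hd (fun i hi b => ?_) a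
    obtain rfl : i = n := by omega
    exact σ_mul_mul_σ_mem (ih b)

end Generic

/-! ### Markov functions on the framed braid groups -/

section Markov

variable {R : Type*} [CommRing R] {M : Type*} [AddCommGroup M] [Module R M]

/-- A Markov function with values in an `R`-module: a family of class functions on the framed braid
groups that is compatible with the inclusions, factors through the quadratic relations with
parameter `κ = (q - q⁻¹) / d`, and satisfies the Markov rule with parameter `z` and the framing rule
with parameters `x k` (for all `k`, not only for `1 ≤ k ≤ d - 1`). No value at `1` is prescribed. -/
structure IsMarkovFunction (d : ℕ) (κ z : R) (x : ℕ → R) (T : ∀ n, FramedBraidGroup d n → M) :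
    Prop where
  compat : ∀ n a, T (n + 1) (grpIncl d n a) = T n a
  trace : ∀ n a b, T n (a * b) = T n (b * a)
  quad : ∀ n i (hi : i + 1 < n) b, T n (σ d n i hi * σ d n i hi * b) = T n b +
    κ • ∑ s ∈ Finset.range d, T n (tGrp d n ⟨i, by omega⟩ ^ s * tGrp d n ⟨i + 1, hi⟩ ^ (d - s) *
      σ d n i hi * b)
  markov : ∀ n a, T (n + 2) (grpIncl d (n + 1) a * σ d (n + 2) n (by omega)) = z • T (n + 1) a
  framing : ∀ n a k, T (n + 1) (grpIncl d n a * tGrp d (n + 1) (Fin.last n) ^ k) = x k • T n a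

namespace IsMarkovFunction

variable {d : ℕ} {κ z : R} {x : ℕ → R} {T : ∀ n, FramedBraidGroup d n → M}

theorem sub {T' : ∀ n, FramedBraidGroup d n → M} (h : IsMarkovFunction d κ z x T)
    (h' : IsMarkovFunction d κ z x T') : IsMarkovFunction d κ z x (fun n a => T n a - T' n a) where
  compat n a := by rw [h.compat, h'.compat]
  trace n a b := by rw [h.trace, h'.trace]
  quad n i hi b := by rw [h.quad, h'.quad, Finset.sum_sub_distrib, smul_sub]; abel
  markov n a := by rw [h.markov, h'.markov, smul_sub]
  framing n a k := by rw [h.framing, h'.framing, smul_sub]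

/-- A Markov function defines linear maps on the generic Yokonuma--Hecke algebras. -/
theorem exists_linear (h : IsMarkovFunction d κ z x T) (n : ℕ) :
    ∃ f : GenY d n κ →ₗ[R] M, ∀ a, f (toGenY d n κ a) = T n a := by
  obtain ⟨f, hf⟩ := exists_linear_lift (GenRel d n κ) (linExt R (T n)) (by
    rintro _ _ ⟨i, hi⟩ u v
    induction u using MonoidAlgebra.induction_on with
    | of u =>
      induction v using MonoidAlgebra.induction_on with
      | of v =>
        simp only [mul_add, add_mul, mul_one, mul_smul_comm, smul_mul_assoc, Finset.mul_sum,
          Finset.sum_mul, map_add, map_smul, map_sum, ← map_mul, linExt_of]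
        have hcyc : ∀ y, T n (u * y * v) = T n (y * (v * u)) := by
          intro y
          rw [mul_assoc, h.trace, mul_assoc]
        simp only [hcyc, h.quad]
        rw [h.trace n u v]
      | add v w hv hw => simp only [mul_add, map_add] at hv hw ⊢; rw [hv, hw]
      | smul r v hv => simp only [mul_smul_comm, map_smul] at hv ⊢; rw [hv]
    | add u w hu hw =>
      rw [add_mul u w, add_mul u w, add_mul (u * _), add_mul (u * _), map_add, map_add, hu, hw]
    | smul r u hu => simp only [smul_mul_assoc r u, smul_mul_assoc r (u * _), map_smul, hu])
  exact ⟨f, fun a => by rw [← linExt_of (R := R) (T n) a, ← hf]; rfl⟩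

/-- The values of a Markov function lie in every submodule that contains its value at `1`. For the
zero submodule this is a uniqueness statement, for the multiples of the value at `1` it says that
the values are polynomials in the parameters. -/
theorem mem_of_one_mem (hd : 1 ≤ d) (h : IsMarkovFunction d κ z x T) (L : Submodule R M)
    (h1 : T 0 1 ∈ L) (n : ℕ) (a : FramedBraidGroup d n) : T n a ∈ L := by
  choose f hf using h.exists_linear
  have compat : ∀ n a, f (n + 1) (genYIncl d n κ a) = f n a := by
    intro n a
    induction a using genY_induction with
    | of a => rw [genYIncl_toGenY, hf, hf, h.compat]
    | add a b ha hb => simp only [map_add, ha, hb]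
    | smul r a ha => simp only [map_smul, ha]
  have trace : ∀ n a b, f n (a * b) = f n (b * a) := by
    intro n a b
    induction a using genY_induction with
    | of a =>
      induction b using genY_induction with
      | of b => rw [← map_mul, ← map_mul, hf, hf, h.trace]
      | add a b ha hb => simp only [map_add, add_mul, mul_add, ha, hb]
      | smul r a ha => simp only [map_smul, mul_smul_comm, smul_mul_assoc, ha]
    | add a b ha hb => simp only [map_add, add_mul, mul_add, ha, hb]
    | smul r a ha => simp only [map_smul, mul_smul_comm, smul_mul_assoc, ha]
  have markov : ∀ n a, f (n + 2) (genYIncl d (n + 1) κ a *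
      toGenY d (n + 2) κ (σ d (n + 2) n (by omega))) = z • f (n + 1) a := by
    intro n a
    induction a using genY_induction with
    | of a => rw [genYIncl_toGenY, ← map_mul, hf, hf, h.markov]
    | add a b ha hb => simp only [map_add, add_mul, smul_add, ha, hb]
    | smul r a ha => simp only [map_smul, smul_mul_assoc, ha, smul_comm z r]
  have framing : ∀ n a k, f (n + 1) (genYIncl d n κ a *
      toGenY d (n + 1) κ (tGrp d (n + 1) (Fin.last n) ^ k)) = x k • f n a := by
    intro n a k
    induction a using genY_induction with
    | of a => rw [genYIncl_toGenY, ← map_mul, hf, hf, h.framing]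
    | add a b ha hb => simp only [map_add, add_mul, smul_add, ha, hb]
    | smul r a ha => simp only [map_smul, smul_mul_assoc, ha, smul_comm (x k) r]
  have key : ∀ n a, f n a ∈ L := by
    intro n
    induction n with
    | zero =>
      intro a
      refine genY_submodule_eq_top hd (L.comap (f 0)) ?_ (fun i hi => by omega)
        (fun j => j.elim0) a
      rwa [Submodule.mem_comap, ← map_one (toGenY d 0 κ), hf]
    | succ n ih =>
      intro a
      have ha := mem_genYSpan hd a
      induction ha using Submodule.span_induction with
      | mem y hy =>
        rcases hy with ⟨a, k, rfl⟩ | ⟨a, b, i, rfl, rfl⟩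
        · rw [framing]; exact L.smul_mem _ (ih a)
        · rw [trace, ← mul_assoc, ← map_mul, markov]; exact L.smul_mem _ (ih _)
      | zero => simp
      | add u v _ _ hu hv => rw [map_add]; exact add_mem hu hv
      | smul r u _ hu => rw [map_smul]; exact L.smul_mem _ hu
  rw [← hf]
  exact key n _

end IsMarkovFunction

end Markov

/-! ### The R-matrix representation -/

section RMatrix

variable {C : Type*} {N : ℕ}

/-- The operator of `t_j`: multiplication by the character value of the colour of the `j`-th
letter. -/
def opT (χ : C → ℂ) (n : ℕ) (j : Fin n) : Module.End ℂ ((Fin n → C × Fin N) → ℂ) where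
  toFun f x := χ (x j).1 * f x
  map_add' f f' := by ext x; simp only [Pi.add_apply]; ring
  map_smul' r f := by ext x; simp only [Pi.smul_apply, smul_eq_mul, RingHom.id_apply]; ring

theorem opT_apply (χ : C → ℂ) (n : ℕ) (j : Fin n) (f : (Fin n → C × Fin N) → ℂ) (x) :
    opT χ n j f x = χ (x j).1 * f x := rfl

theorem opT_pow_apply (χ : C → ℂ) (n : ℕ) (j : Fin n) (k : ℕ) (f : (Fin n → C × Fin N) → ℂ) (x) :
    (opT χ n j ^ k) f x = χ (x j).1 ^ k * f x := by
  induction k with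
  | zero => simp
  | succ k ih => rw [pow_succ', Module.End.mul_apply, opT_apply, ih, pow_succ']; ring

variable [DecidableEq C]

/-- The coefficient of `v_b ⊗ v_a` in the R-matrix. The first component of an index is its colour,
the second its level. -/
def rFlip (a b : C × Fin N) : ℂ := if a = b then 0 else 1

/-- The diagonal coefficient of the R-matrix: `q` on equal letters, and `q - q⁻¹` on letters of the
same colour in decreasing order of levels. -/
def rDiag (q : ℂ) (a b : C × Fin N) : ℂ :=
  if a = b then q else if a.1 = b.1 ∧ b.2 < a.2 then q - q⁻¹ else 0

theorem rDiag_of_ne {q : ℂ} {a b : C × Fin N} (h : a.1 ≠ b.1) : rDiag q a b = 0 := by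
  rw [rDiag, if_neg (fun h' => h (congrArg Prod.fst h')), if_neg (fun h' => h h'.1)]

/-- Together with `r_quad_diag`, the quadratic relation for the R-matrix; the factor
`if a.1 = b.1 then _ else 0` is the eigenvalue of `(q - q⁻¹) e`. -/
theorem r_quad_flip {q : ℂ} (a b : C × Fin N) :
    rFlip a b * (rDiag q b a + rDiag q a b) =
      (if a.1 = b.1 then q - q⁻¹ else 0) * rFlip a b := by
  obtain ⟨a, i⟩ := a
  obtain ⟨b, j⟩ := b
  simp only [rFlip, rDiag, Prod.mk.injEq]
  grind

theorem r_quad_diag {q : ℂ} (hq : q ≠ 0) (a b : C × Fin N) :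
    rFlip a b * rFlip b a + rDiag q a b * rDiag q a b =
      1 + (if a.1 = b.1 then q - q⁻¹ else 0) * rDiag q a b := by
  obtain ⟨a, i⟩ := a
  obtain ⟨b, j⟩ := b
  simp only [rFlip, rDiag, Prod.mk.injEq]
  split_ifs <;> grind

/-- The three lemmas `r_braid₁`, `r_braid₂`, `r_braid₃` compare the coefficients of `f` at the words
`b a c`, `a c b` and `a b c` in the braid relation; the other coefficients agree identically. -/
theorem r_braid₁ {q : ℂ} (hq : q ≠ 0) (a b c : C × Fin N) :
    rFlip a b * (rDiag q a c * rDiag q b a + rDiag q a b * rDiag q b c) =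
      rFlip a b * (rDiag q b c * rDiag q a c) := by
  obtain ⟨a, i⟩ := a
  obtain ⟨b, j⟩ := b
  obtain ⟨c, k⟩ := c
  simp only [rFlip, rDiag, Prod.mk.injEq]
  grind

theorem r_braid₂ {q : ℂ} (hq : q ≠ 0) (a b c : C × Fin N) :
    rFlip b c * (rDiag q a c * rDiag q c b + rDiag q b c * rDiag q a b) =
      rFlip b c * (rDiag q a b * rDiag q a c) := by
  obtain ⟨a, i⟩ := a
  obtain ⟨b, j⟩ := b
  obtain ⟨c, k⟩ := c
  simp only [rFlip, rDiag, Prod.mk.injEq]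
  grind

theorem r_braid₃ {q : ℂ} (hq : q ≠ 0) (a b c : C × Fin N) :
    rFlip a b * rDiag q a c * rFlip b a + rDiag q a b * rDiag q b c * rDiag q a b =
      rFlip b c * rDiag q a c * rFlip c b + rDiag q b c * rDiag q a b * rDiag q b c := by
  obtain ⟨a, i⟩ := a
  obtain ⟨b, j⟩ := b
  obtain ⟨c, k⟩ := c
  simp only [rFlip, rDiag, Prod.mk.injEq]
  grind

/-- The operator of `σ_i`: the R-matrix on the tensor factors `i` and `i + 1`, acting on functions
on the set of words of length `n`. -/
def opσ (q : ℂ) (n i : ℕ) (hi : i + 1 < n) : Module.End ℂ ((Fin n → C × Fin N) → ℂ) where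
  toFun f x := rFlip (x ⟨i, by omega⟩) (x ⟨i + 1, hi⟩) * f (x ∘ adjSwap n i hi) +
    rDiag q (x ⟨i, by omega⟩) (x ⟨i + 1, hi⟩) * f x
  map_add' f f' := by ext x; simp only [Pi.add_apply]; ring
  map_smul' r f := by ext x; simp only [Pi.smul_apply, smul_eq_mul, RingHom.id_apply]; ring

theorem opσ_apply (q : ℂ) (n i : ℕ) (hi : i + 1 < n) (f : (Fin n → C × Fin N) → ℂ) (x) :
    opσ q n i hi f x = rFlip (x ⟨i, by omega⟩) (x ⟨i + 1, hi⟩) * f (x ∘ adjSwap n i hi) +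
    rDiag q (x ⟨i, by omega⟩) (x ⟨i + 1, hi⟩) * f x := rfl

theorem swap_braid {α : Type*} [DecidableEq α] {a b c : α} (hab : a ≠ b) (hac : a ≠ c)
    (hbc : b ≠ c) : Equiv.swap a b * Equiv.swap b c * Equiv.swap a b =
      Equiv.swap b c * Equiv.swap a b * Equiv.swap b c := by
  rw [Equiv.swap_mul_swap_mul_swap hab hac, Equiv.swap_comm a b, Equiv.swap_comm b c,
    Equiv.swap_mul_swap_mul_swap hbc.symm hac.symm, Equiv.swap_comm]

theorem opσ_braid {q : ℂ} (hq : q ≠ 0) (n i : ℕ) (hi : i + 2 < n) :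
    opσ (C := C) (N := N) q n i (by omega) * opσ q n (i + 1) hi * opσ q n i (by omega) =
      opσ q n (i + 1) hi * opσ q n i (by omega) * opσ q n (i + 1) hi := by
  ext1 f
  funext x
  have e1 : ∀ y : Fin n → C × Fin N, y ∘ adjSwap n i (by omega) ∘ adjSwap n i (by omega) = y := by
    intro y; ext1 j; simp [adjSwap]
  have e2 : ∀ y : Fin n → C × Fin N, y ∘ adjSwap n (i + 1) hi ∘ adjSwap n (i + 1) hi = y := by
    intro y; ext1 j; simp [adjSwap]
  have e3 : ∀ y : Fin n → C × Fin N,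
      y ∘ adjSwap n i (by omega) ∘ adjSwap n (i + 1) hi ∘ adjSwap n i (by omega) =
      y ∘ adjSwap n (i + 1) hi ∘ adjSwap n i (by omega) ∘ adjSwap n (i + 1) hi := by
    intro y
    have : adjSwap n i (by omega) * adjSwap n (i + 1) hi * adjSwap n i (by omega) =
        adjSwap n (i + 1) hi * adjSwap n i (by omega) * adjSwap n (i + 1) hi :=
      swap_braid (by simp) (by simp; omega) (by simp)
    ext1 j
    exact congrArg y (Equiv.congr_fun this j)
  generalize hs : adjSwap n i (by omega) = p at e1 e3 ⊢
  generalize hs' : adjSwap n (i + 1) hi = p' at e2 e3 ⊢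
  have s1 := adjSwap_left n i (by omega)
  have s2 := adjSwap_right n i (by omega)
  have s3 := adjSwap_of_ne n i (by omega) ⟨i + 2, hi⟩ (by simp) (by simp)
  have s4 := adjSwap_left n (i + 1) hi
  have s5 := adjSwap_right n (i + 1) hi
  have s6 := adjSwap_of_ne n (i + 1) hi ⟨i, by omega⟩ (by simp) (by simp; omega)
  rw [hs] at s1 s2 s3
  rw [hs'] at s4 s5 s6
  simp only [Module.End.mul_apply, opσ_apply, hs, hs', Function.comp_assoc, Function.comp_apply,
    s1, s2, s3, s4, s5, s6, e1, e2, e3]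
  set a := x ⟨i, by omega⟩
  set b := x ⟨i + 1, by omega⟩
  set c := x ⟨i + 2, hi⟩
  have h1 := r_braid₁ hq a b c
  have h2 := r_braid₂ hq a b c
  have h3 := r_braid₃ hq a b c
  linear_combination f (x ∘ p) * h1 - f (x ∘ p') * h2 + f x * h3

theorem opσ_far {q : ℂ} (n i j : ℕ) (hi : i + 1 < n) (hj : j + 1 < n) (h : j + 1 < i) :
    opσ (C := C) (N := N) q n i hi * opσ q n j hj = opσ q n j hj * opσ q n i hi := by
  ext1 f
  funext x
  have e3 : ∀ y : Fin n → C × Fin N, y ∘ adjSwap n i hi ∘ adjSwap n j hj =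
      y ∘ adjSwap n j hj ∘ adjSwap n i hi := by
    intro y
    have : adjSwap n i hi * adjSwap n j hj = adjSwap n j hj * adjSwap n i hi := by
      refine (Equiv.Perm.disjoint_swap_swap ?_).commute
      simp only [List.nodup_cons, List.mem_cons, Fin.mk.injEq, List.not_mem_nil, or_false, not_or,
        not_false_eq_true, List.nodup_nil, and_true]
      omega
    ext1 j
    exact congrArg y (Equiv.congr_fun this j)
  have s1 := adjSwap_of_ne n i hi ⟨j, by omega⟩ (by dsimp only; omega) (by dsimp only; omega)
  have s2 := adjSwap_of_ne n i hi ⟨j + 1, hj⟩ (by dsimp only; omega) (by dsimp only; omega)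
  have s3 := adjSwap_of_ne n j hj ⟨i, by omega⟩ (by dsimp only; omega) (by dsimp only; omega)
  have s4 := adjSwap_of_ne n j hj ⟨i + 1, hi⟩ (by dsimp only; omega) (by dsimp only; omega)
  simp only [Module.End.mul_apply, opσ_apply, Function.comp_assoc, Function.comp_apply, s1, s2, s3,
    s4, e3]
  ring

theorem opT_mul_opσ (χ : C → ℂ) {q : ℂ} (n i : ℕ) (hi : i + 1 < n) (j : Fin n) :
    opT (N := N) χ n j * opσ q n i hi = opσ q n i hi * opT χ n (adjSwap n i hi j) := by
  ext1 f
  funext x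
  simp only [Module.End.mul_apply, opσ_apply, opT_apply, Function.comp_apply]
  have h1 : adjSwap n i hi (adjSwap n i hi j) = j := by simp [adjSwap]
  have h2 : χ (x j).1 * rDiag q (x ⟨i, by omega⟩) (x ⟨i + 1, hi⟩) =
      χ (x (adjSwap n i hi j)).1 * rDiag q (x ⟨i, by omega⟩) (x ⟨i + 1, hi⟩) := by
    by_cases hc : (x ⟨i, by omega⟩).1 = (x ⟨i + 1, hi⟩).1
    · congr 2
      rcases eq_or_ne j ⟨i, by omega⟩ with hj | hj
      · rw [hj, adjSwap_left, hc]
      rcases eq_or_ne j ⟨i + 1, hi⟩ with hj' | hj'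
      · rw [hj', adjSwap_right, hc]
      rw [adjSwap_of_ne _ _ _ _ (fun h => hj (Fin.ext h)) (fun h => hj' (Fin.ext h))]
    · rw [rDiag_of_ne hc, mul_zero, mul_zero]
  rw [h1]
  linear_combination f x * h2

theorem opσ_quad (χ : C → ℂ) {d : ℕ} (hd : 1 ≤ d)
    (hχ : ∀ a b, ∑ s ∈ Finset.range d, χ a ^ s * χ b ^ (d - s) = if a = b then (d : ℂ) else 0)
    {q : ℂ} (hq : q ≠ 0) (n i : ℕ) (hi : i + 1 < n) :
    opσ (N := N) q n i hi * opσ q n i hi = 1 + ((q - q⁻¹) / d) • ∑ s ∈ Finset.range d,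
      opT χ n ⟨i, by omega⟩ ^ s * opT χ n ⟨i + 1, hi⟩ ^ (d - s) * opσ q n i hi := by
  ext1 f
  funext x
  have e1 : (x ∘ adjSwap n i hi) ∘ adjSwap n i hi = x := by
    ext1 j; simp [adjSwap]
  have hd' : (d : ℂ) ≠ 0 := by exact_mod_cast (by omega : d ≠ 0)
  simp only [LinearMap.add_apply, Module.End.one_apply, LinearMap.smul_apply, Pi.add_apply,
    Pi.smul_apply, LinearMap.sum_apply, Finset.sum_apply, Module.End.mul_apply, opT_pow_apply,
    ← mul_assoc, ← Finset.sum_mul, hχ]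
  simp only [opσ_apply, e1, Function.comp_apply, adjSwap_left, adjSwap_right, smul_eq_mul]
  set a := x ⟨i, by omega⟩
  set b := x ⟨i + 1, by omega⟩
  have h1 := r_quad_flip (q := q) a b
  have h2 := r_quad_diag hq a b
  have h3 : (q - q⁻¹) / d * (if a.1 = b.1 then (d : ℂ) else 0) =
      if a.1 = b.1 then q - q⁻¹ else 0 := by
    split_ifs
    · field_simp
    · simp
  rw [← mul_assoc, h3]
  linear_combination f (x ∘ adjSwap n i hi) * h1 + f x * h2

end RMatrix

/-! ### Characters of `ℤ/dℤ` -/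

/-- The value at `1` of the character of `ℤ/dℤ` indexed by `j`. -/
def chi (d : ℕ) (j : ZMod d) : ℂ := Complex.exp (2 * Real.pi * Complex.I / d) ^ j.val

theorem chi_pow {d : ℕ} (hd : 1 ≤ d) (j : ZMod d) : chi d j ^ d = 1 := by
  rw [chi, pow_right_comm, (Complex.isPrimitiveRoot_exp d (by omega)).pow_eq_one, one_pow]

theorem chi_injective {d : ℕ} (hd : 1 ≤ d) : Function.Injective (chi d) := by
  have : NeZero d := ⟨by omega⟩
  intro a b h
  exact ZMod.val_injective d ((Complex.isPrimitiveRoot_exp d (by omega)).pow_inj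
    (ZMod.val_lt a) (ZMod.val_lt b) h)

theorem sum_chi {d : ℕ} (hd : 1 ≤ d) (a b : ZMod d) :
    ∑ s ∈ Finset.range d, chi d a ^ s * chi d b ^ (d - s) = if a = b then (d : ℂ) else 0 := by
  have hb0 : chi d b ≠ 0 := fun h => by
    have := chi_pow hd b
    rw [h, zero_pow (by omega)] at this
    exact zero_ne_one this
  have h1 : ∀ s ∈ Finset.range d, chi d a ^ s * chi d b ^ (d - s) = (chi d a / chi d b) ^ s := by
    intro s hs
    rw [pow_sub₀ _ hb0 (Finset.mem_range.1 hs).le, chi_pow hd, one_mul, div_pow, div_eq_mul_inv]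
  rw [Finset.sum_congr rfl h1]
  split_ifs with h
  · simp [h, div_self hb0]
  · have hne : chi d a / chi d b ≠ 1 := fun h' =>
      h (chi_injective hd ((div_eq_one_iff_eq hb0).1 h'))
    rw [geom_sum_eq hne, div_pow, chi_pow hd, chi_pow hd, div_one, sub_self, zero_div]

theorem xD_eq (d : ℕ) (D : Finset (ZMod d)) (k : ℕ) :
    xD d D k = 1 / (D.card : ℂ) * ∑ j : D, chi d j ^ k := by
  rw [xD, ← Finset.sum_coe_sort D]
  congr 1
  refine Finset.sum_congr rfl fun j _ => ?_
  rw [chi, ← pow_mul, ← Complex.exp_nat_mul]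
  congr 1
  push_cast
  ring

theorem xD_zero {d : ℕ} {D : Finset (ZMod d)} (hD : 1 ≤ D.card) : xD d D 0 = 1 := by
  have : (D.card : ℂ) ≠ 0 := by exact_mod_cast (by omega : D.card ≠ 0)
  simp [xD, this]

theorem xD_mod {d : ℕ} (hd : 1 ≤ d) (D : Finset (ZMod d)) (k : ℕ) : xD d D (k % d) = xD d D k := by
  rw [xD_eq, xD_eq]
  congr 1
  refine Finset.sum_congr rfl fun j _ => ?_
  conv_rhs => rw [← Nat.div_add_mod k d, pow_add, pow_mul, chi_pow hd, one_pow, one_mul]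

/-- The identity behind the E-system: averaging a character over the solution `x_D` gives
`1 / |D|` for the characters in `D`. -/
theorem sum_xD_mul_chi {d : ℕ} (hd : 1 ≤ d) {D : Finset (ZMod d)} (a : D) :
    ∑ s ∈ Finset.range d, xD d D (d - s) * chi d a ^ s = d * (1 / (D.card : ℂ)) := by
  simp only [xD_eq, mul_assoc, Finset.sum_mul, ← Finset.mul_sum]
  rw [Finset.sum_comm]
  simp only [mul_comm (chi d _ ^ (d - _)), sum_chi hd, Finset.sum_ite_eq, Subtype.coe_inj,
    Finset.mem_univ, if_true]
  ring

/-! ### The trace of the R-matrix representation -/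

section Rep

variable {d : ℕ} {D : Finset (ZMod d)} {N : ℕ}

/-- Words of length `n` in the letters `D × Fin N`. -/
abbrev Word (D : Finset (ZMod d)) (N n : ℕ) : Type := Fin n → D × Fin N

/-- The characters of the colours in `D`. -/
abbrev colourChar (D : Finset (ZMod d)) (c : D) : ℂ := chi d c

theorem isUnit_opT (hd : 1 ≤ d) (n : ℕ) (j : Fin n) :
    IsUnit (opT (N := N) (colourChar D) n j) := by
  have h : opT (N := N) (colourChar D) n j ^ d = 1 := by
    refine LinearMap.ext fun f => ?_
    funext x
    rw [opT_pow_apply, chi_pow hd, one_mul, Module.End.one_apply]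
  exact IsUnit.of_pow_eq_one h (by omega)

theorem opσ_quad' (hd : 1 ≤ d) {q : ℂ} (hq : q ≠ 0) (n i : ℕ) (hi : i + 1 < n) :
    opσ (C := D) (N := N) q n i hi * opσ q n i hi = 1 + ((q - q⁻¹) / d) • ∑ s ∈ Finset.range d,
      opT (colourChar D) n ⟨i, by omega⟩ ^ s * opT (colourChar D) n ⟨i + 1, hi⟩ ^ (d - s) *
        opσ q n i hi :=
  opσ_quad (colourChar D) hd (fun a b => by rw [sum_chi hd]; simp only [Subtype.coe_inj]) hq n i hi

theorem isUnit_opσ (hd : 1 ≤ d) {q : ℂ} (hq : q ≠ 0) (n i : ℕ) (hi : i + 1 < n) :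
    IsUnit (opσ (C := D) (N := N) q n i hi) := by
  have h := opσ_quad' (D := D) (N := N) hd hq n i hi
  rw [← Finset.sum_mul, ← smul_mul_assoc, ← sub_eq_iff_eq_add, ← sub_mul] at h
  exact IsUnit.of_mul_eq_one_right _ h

/-- The operators of the generators as units. -/
def genUnit (D : Finset (ZMod d)) (N : ℕ) (hd : 1 ≤ d) {q : ℂ} (hq : q ≠ 0) (n : ℕ) :
    Gen n → (Module.End ℂ (Word D N n → ℂ))ˣ
  | Gen.sigma i hi => (isUnit_opσ hd hq n i hi).unit
  | Gen.framing j => (isUnit_opT hd n j).unit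

theorem genUnit_rel (D : Finset (ZMod d)) (N : ℕ) (hd : 1 ≤ d) {q : ℂ} (hq : q ≠ 0) (n : ℕ) :
    ∀ r ∈ relators d n, FreeGroup.lift (genUnit D N hd hq n) r = 1 := by
  rintro _ ⟨x, y, h, rfl⟩
  rw [map_mul, map_inv, mul_inv_eq_one, Units.ext_iff]
  cases h with
  | braid i j hi hj h =>
    simp only [map_mul, fσ, FreeGroup.lift_apply_of, genUnit, Units.val_mul, IsUnit.unit_spec]
    rcases h with rfl | rfl
    · exact (opσ_braid hq n j hi).symm
    · exact opσ_braid hq n i hj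
  | far i j hi hj h =>
    simp only [map_mul, fσ, FreeGroup.lift_apply_of, genUnit, Units.val_mul, IsUnit.unit_spec]
    rcases h with h | h
    · exact opσ_far n i j hi hj h
    · exact (opσ_far n j i hj hi h).symm
  | framing_comm i j =>
    simp only [map_mul, ft, FreeGroup.lift_apply_of, genUnit, Units.val_mul, IsUnit.unit_spec]
    refine LinearMap.ext fun f => ?_
    funext x
    simp only [Module.End.mul_apply, opT_apply]
    ring
  | framing_braid i hi j =>
    simp only [map_mul, fσ, ft, FreeGroup.lift_apply_of, genUnit, Units.val_mul, IsUnit.unit_spec]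
    exact opT_mul_opσ _ n i hi j
  | modular j =>
    simp only [map_pow, map_one, ft, FreeGroup.lift_apply_of, genUnit, Units.val_pow_eq_pow_val,
      Units.val_one, IsUnit.unit_spec]
    refine LinearMap.ext fun f => ?_
    funext x
    rw [opT_pow_apply, chi_pow hd, one_mul, Module.End.one_apply]

/-- The R-matrix representation of the framed braid group on functions on words. -/
def rep (D : Finset (ZMod d)) (N : ℕ) (hd : 1 ≤ d) {q : ℂ} (hq : q ≠ 0) (n : ℕ) :
    FramedBraidGroup d n →* (Module.End ℂ (Word D N n → ℂ))ˣ :=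
  PresentedGroup.toGroup (genUnit_rel D N hd hq n)

theorem rep_σ (hd : 1 ≤ d) {q : ℂ} (hq : q ≠ 0) (n i : ℕ) (hi : i + 1 < n) :
    (rep D N hd hq n (σ d n i hi) : Module.End ℂ (Word D N n → ℂ)) = opσ q n i hi := by
  rw [rep, σ, PresentedGroup.toGroup.of]; rfl

theorem rep_t (hd : 1 ≤ d) {q : ℂ} (hq : q ≠ 0) (n : ℕ) (j : Fin n) :
    (rep D N hd hq n (tGrp d n j) : Module.End ℂ (Word D N n → ℂ)) =
      opT (colourChar D) n j := by
  rw [rep, tGrp, PresentedGroup.toGroup.of]; rfl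

/-- Restriction of a function to the words with last letter `b`. -/
def slice (n : ℕ) (b : D × Fin N) : (Word D N (n + 1) → ℂ) →ₗ[ℂ] (Word D N n → ℂ) where
  toFun f x := f (Fin.snoc (α := fun _ => D × Fin N) x b)
  map_add' _ _ := rfl
  map_smul' _ _ := rfl

theorem slice_apply (n : ℕ) (b : D × Fin N) (f : Word D N (n + 1) → ℂ) (x : Word D N n) :
    slice n b f x = f (Fin.snoc (α := fun _ => D × Fin N) x b) := rfl

theorem snoc_castSucc' {n : ℕ} (x : Word D N n) (b : D × Fin N) (j : Fin n) :
    Fin.snoc (α := fun _ => D × Fin N) x b j.castSucc = x j := by simp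

theorem slice_opσ (q : ℂ) (n i : ℕ) (hi : i + 1 < n) (b : D × Fin N)
    (f : Word D N (n + 1) → ℂ) :
    slice n b (opσ q (n + 1) i (by omega) f) = opσ q n i hi (slice n b f) := by
  funext x
  have h : Fin.snoc (α := fun _ => D × Fin N) x b ∘ adjSwap (n + 1) i (by omega) =
      Fin.snoc (α := fun _ => D × Fin N) (x ∘ adjSwap n i hi) b := by
    funext j
    induction j using Fin.lastCases with
    | last =>
      rw [Function.comp_apply, adjSwap_of_ne]
      · simp
      · simp only [Fin.val_last]; omega
      · simp only [Fin.val_last]; omega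
    | cast j =>
      rw [Function.comp_apply, ← castSucc_adjSwap n i hi, snoc_castSucc', snoc_castSucc']
      rfl
  rw [slice_apply, opσ_apply, opσ_apply, slice_apply, slice_apply, h]
  have h1 := snoc_castSucc' x b ⟨i, by omega⟩
  have h2 := snoc_castSucc' x b ⟨i + 1, by omega⟩
  simp only [Fin.castSucc_mk] at h1 h2
  rw [h1, h2]

theorem slice_opT (n : ℕ) (j : Fin n) (b : D × Fin N) (f : Word D N (n + 1) → ℂ) :
    slice n b (opT (colourChar D) (n + 1) j.castSucc f) =
      opT (colourChar D) n j (slice n b f) := by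
  funext x
  rw [slice_apply, opT_apply, opT_apply, slice_apply, snoc_castSucc']

/-- The elements of `F_{d,n}` act on words of length `n + 1` through the first `n` letters. -/
theorem slice_rep (hd : 1 ≤ d) {q : ℂ} (hq : q ≠ 0) (n : ℕ) (a : FramedBraidGroup d n)
    (b : D × Fin N) (f : Word D N (n + 1) → ℂ) :
    slice n b ((rep D N hd hq (n + 1) (grpIncl d n a)).val f) =
      (rep D N hd hq n a).val (slice n b f) := by
  let H : Subgroup (FramedBraidGroup d n) :=
    { carrier := {a | ∀ f, slice n b ((rep D N hd hq (n + 1) (grpIncl d n a)).val f) =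
        (rep D N hd hq n a).val (slice n b f)}
      mul_mem' := by
        intro x y hx hy f
        simp only [map_mul, Units.val_mul, Module.End.mul_apply]
        rw [hx, hy]
      one_mem' := by intro f; simp
      inv_mem' := by
        intro x hx f
        have h1 := hx ((rep D N hd hq (n + 1) (grpIncl d n x⁻¹)).val f)
        rw [← Module.End.mul_apply, ← Units.val_mul, ← map_mul, ← map_mul, mul_inv_cancel,
          map_one, map_one, Units.val_one, Module.End.one_apply] at h1
        rw [h1, ← Module.End.mul_apply, ← Units.val_mul, ← map_mul, inv_mul_cancel,
          map_one, Units.val_one, Module.End.one_apply] }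
  refine framedBraid_induction H ?_ ?_ a f
  · intro i hi f
    rw [grpIncl_σ, rep_σ, rep_σ, slice_opσ]
  · intro j f
    rw [grpIncl_t, rep_t, rep_t, slice_opT]

/-- The weight of a word, the product of the weights of its letters. -/
def wordWeight (w : D × Fin N → ℂ) {n : ℕ} (x : Word D N n) : ℂ := ∏ j, w (x j)

theorem wordWeight_snoc (w : D × Fin N → ℂ) {n : ℕ} (x : Word D N n) (b : D × Fin N) :
    wordWeight w (Fin.snoc (α := fun _ => D × Fin N) x b) = wordWeight w x * w b := by
  rw [wordWeight, Fin.prod_univ_castSucc]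
  simp [wordWeight]

/-- Weights are preserved: the operators of the framed braid group commute with multiplication by
the weight. -/
theorem rep_weight (hd : 1 ≤ d) {q : ℂ} (hq : q ≠ 0) (w : D × Fin N → ℂ) (n : ℕ)
    (a : FramedBraidGroup d n) (f : Word D N n → ℂ) :
    (rep D N hd hq n a).val (fun x => wordWeight w x * f x) =
      fun x => wordWeight w x * (rep D N hd hq n a).val f x := by
  let H : Subgroup (FramedBraidGroup d n) :=
    { carrier := {a | ∀ f, (rep D N hd hq n a).val (fun x => wordWeight w x * f x) =
        fun x => wordWeight w x * (rep D N hd hq n a).val f x}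
      mul_mem' := by
        intro x y hx hy f
        simp only [map_mul, Units.val_mul, Module.End.mul_apply]
        rw [hy, hx]
      one_mem' := by intro f; simp
      inv_mem' := by
        intro x hx f
        have h1 := hx ((rep D N hd hq n x⁻¹).val f)
        rw [← Module.End.mul_apply (rep D N hd hq n x).val, ← Units.val_mul, ← map_mul,
          mul_inv_cancel, map_one, Units.val_one, Module.End.one_apply] at h1
        rw [← h1, ← Module.End.mul_apply, ← Units.val_mul, ← map_mul, inv_mul_cancel,
          map_one, Units.val_one, Module.End.one_apply] }
  refine framedBraid_induction H ?_ ?_ a f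
  · intro i hi f
    funext x
    have : wordWeight w (x ∘ adjSwap n i hi) = wordWeight w x :=
      Equiv.prod_comp (adjSwap n i hi) (fun j => w (x j))
    rw [rep_σ, opσ_apply, opσ_apply, this]
    ring
  · intro j f
    funext x
    rw [rep_t, opT_apply, opT_apply]
    ring

/-- The weighted trace of an operator. -/
def wtr (w : D × Fin N → ℂ) (n : ℕ) (φ : Module.End ℂ (Word D N n → ℂ)) : ℂ :=
  ∑ x, wordWeight w x * φ (Pi.single x 1) x

theorem end_apply_eq_sum {n : ℕ} (φ : Module.End ℂ (Word D N n → ℂ)) (f : Word D N n → ℂ)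
    (x : Word D N n) : φ f x = ∑ y, f y * φ (Pi.single y 1) x := by
  conv_lhs => rw [pi_eq_sum_univ' f]
  simp only [map_sum, map_smul, Finset.sum_apply, Pi.smul_apply, smul_eq_mul]

theorem wtr_rep_mul_comm (hd : 1 ≤ d) {q : ℂ} (hq : q ≠ 0) (w : D × Fin N → ℂ) (n : ℕ)
    (a b : FramedBraidGroup d n) :
    wtr w n (rep D N hd hq n (a * b)).val = wtr w n (rep D N hd hq n (b * a)).val := by
  have hw : ∀ x y, wordWeight w x * (rep D N hd hq n a).val (Pi.single y 1) x =
      wordWeight w y * (rep D N hd hq n a).val (Pi.single y 1) x := by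
    intro x y
    have h1 := congrFun (rep_weight hd hq w n a (Pi.single y 1)) x
    have h2 : (fun x => wordWeight w x * (Pi.single y 1 : Word D N n → ℂ) x) =
        wordWeight w y • Pi.single y 1 := by
      funext z
      rcases eq_or_ne z y with rfl | h
      · simp
      · simp [h]
    rw [h2, map_smul] at h1
    exact h1.symm
  simp only [wtr, map_mul, Units.val_mul, Module.End.mul_apply]
  simp only [end_apply_eq_sum (rep D N hd hq n a).val ((rep D N hd hq n b).val _),
    end_apply_eq_sum (rep D N hd hq n b).val ((rep D N hd hq n a).val _), Finset.mul_sum]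
  rw [Finset.sum_comm]
  refine Finset.sum_congr rfl fun y _ => Finset.sum_congr rfl fun x _ => ?_
  linear_combination (rep D N hd hq n b).val (Pi.single x 1) y * hw x y

/-- Partial trace over the last letter. -/
theorem wtr_rep_incl_mul (hd : 1 ≤ d) {q : ℂ} (hq : q ≠ 0) (w : D × Fin N → ℂ) (n : ℕ)
    (a : FramedBraidGroup d n) (ψ : Module.End ℂ (Word D N (n + 1) → ℂ))
    (β : Word D N n → D × Fin N → ℂ) (c : ℂ)
    (hψ : ∀ x b, slice n b (ψ (Pi.single (Fin.snoc (α := fun _ => D × Fin N) x b) 1)) =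
      β x b • Pi.single x 1) (hβ : ∀ x, ∑ b, w b * β x b = c) :
    wtr w (n + 1) ((rep D N hd hq (n + 1) (grpIncl d n a)).val * ψ) =
      c * wtr w n (rep D N hd hq n a).val := by
  simp only [wtr]
  rw [← (Fin.snocEquiv (fun _ : Fin (n + 1) => D × Fin N)).sum_comp, Fintype.sum_prod_type,
    Finset.sum_comm, Finset.mul_sum]
  refine Finset.sum_congr rfl fun x _ => ?_
  rw [← hβ x, Finset.sum_mul]
  refine Finset.sum_congr rfl fun b _ => ?_
  change wordWeight w (Fin.snoc (α := fun _ => D × Fin N) x b) *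
    slice n b ((rep D N hd hq (n + 1) (grpIncl d n a)).val (ψ (Pi.single (Fin.snoc
      (α := fun _ => D × Fin N) x b) 1))) x = _
  rw [slice_rep, hψ, map_smul, wordWeight_snoc, Pi.smul_apply, smul_eq_mul]
  ring

end Rep

section RepTrace

variable {d : ℕ} {D : Finset (ZMod d)} {N : ℕ}

/-- The weighted trace of the R-matrix representation is a Markov function as soon as the weights
satisfy the partial trace identity and their sum over each colour is `1 / |D|`. -/
theorem isMarkovFunction_wtr (hd : 1 ≤ d) (hD : 1 ≤ D.card) {q : ℂ} (hq : q ≠ 0)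
    (w : D × Fin N → ℂ) {z : ℂ}
    (hz : ∀ a, ∑ b, w b * rDiag q a b = z) (hw : ∀ c, ∑ i, w (c, i) = 1 / (D.card : ℂ)) :
    IsMarkovFunction d ((q - q⁻¹) / d) z (xD d D)
      (fun n a => wtr w n (rep D N hd hq n a).val) := by
  have framing : ∀ n a k, wtr w (n + 1) (rep D N hd hq (n + 1)
      (grpIncl d n a * tGrp d (n + 1) (Fin.last n) ^ k)).val =
        xD d D k * wtr w n (rep D N hd hq n a).val := by
    intro n a k
    rw [map_mul, map_pow, Units.val_mul, Units.val_pow_eq_pow_val, rep_t]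
    refine wtr_rep_incl_mul hd hq w n a _ (fun _ b => chi d b.1 ^ k) _ ?_ ?_
    · intro x b
      funext y
      rw [slice_apply, opT_pow_apply, Fin.snoc_last, Pi.smul_apply, smul_eq_mul]
      congr 1
      rcases eq_or_ne y x with rfl | h
      · simp
      · rw [Pi.single_eq_of_ne h, Pi.single_eq_of_ne]
        exact fun h' => h (Fin.snoc_left_injective (α := fun _ => D × Fin N) b h')
    · intro _
      rw [Fintype.sum_prod_type]
      simp only [← Finset.sum_mul, hw, ← Finset.mul_sum, xD_eq]
  refine ⟨?_, fun n a b => wtr_rep_mul_comm hd hq w n a b, ?_, ?_, framing⟩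
  · intro n a
    simpa [xD_zero hD] using framing n a 0
  · intro n i hi b
    have h := opσ_quad' (D := D) (N := N) hd hq n i hi
    simp only [map_mul, map_pow, Units.val_mul, Units.val_pow_eq_pow_val, rep_σ, rep_t]
    rw [h, add_mul, one_mul, smul_mul_assoc, Finset.sum_mul]
    simp only [wtr, LinearMap.add_apply, LinearMap.smul_apply, LinearMap.sum_apply, Pi.add_apply,
      Pi.smul_apply, Finset.sum_apply, mul_add, Finset.sum_add_distrib, smul_eq_mul,
      Finset.mul_sum]
    congr 1
    rw [Finset.sum_comm]
    refine Finset.sum_congr rfl fun _ _ => Finset.sum_congr rfl fun _ _ => ?_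
    ring
  · intro n a
    rw [map_mul, Units.val_mul, rep_σ]
    refine wtr_rep_incl_mul hd hq w (n + 1) a _ (fun x b => rDiag q (x (Fin.last n)) b) _ ?_ ?_
    · intro x b
      funext y
      have e1 : Fin.snoc (α := fun _ => D × Fin N) y b ⟨n, by omega⟩ = y (Fin.last n) :=
        snoc_castSucc' y b (Fin.last n)
      have e2 : Fin.snoc (α := fun _ => D × Fin N) y b ⟨n + 1, by omega⟩ = b :=
        Fin.snoc_last (α := fun _ => D × Fin N) b y
      rw [slice_apply, opσ_apply, e1, e2, Pi.smul_apply, smul_eq_mul]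
      have hz1 : rFlip (y (Fin.last n)) b *
          (Pi.single (Fin.snoc (α := fun _ => D × Fin N) x b) 1 : Word D N (n + 2) → ℂ)
            (Fin.snoc (α := fun _ => D × Fin N) y b ∘ adjSwap (n + 1 + 1) n (by omega)) = 0 := by
        by_cases hyb : y (Fin.last n) = b
        · rw [rFlip, if_pos hyb, zero_mul]
        · rw [Pi.single_eq_of_ne, mul_zero]
          intro h
          have h' := congrFun h ⟨n + 1, by omega⟩
          rw [Function.comp_apply, adjSwap_right, e1] at h'
          exact hyb (h'.trans (Fin.snoc_last (α := fun _ => D × Fin N) b x))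
      rw [hz1, zero_add]
      rcases eq_or_ne y x with rfl | h
      · simp
      · rw [Pi.single_eq_of_ne h, Pi.single_eq_of_ne, mul_zero, mul_zero]
        exact fun h' => h (Fin.snoc_left_injective (α := fun _ => D × Fin N) b h')
    · intro x
      exact hz _

/-- The E-system identity for the weighted traces: the second factor of
`e_n = (1/d) ∑_s t_n^s t_{n+1}^{d-s}` has been evaluated by the framing rule. -/
theorem wtr_idem (hd : 1 ≤ d) {q : ℂ} (hq : q ≠ 0) (w : D × Fin N → ℂ) (n : ℕ)
    (a : FramedBraidGroup d (n + 1)) :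
    ∑ s ∈ Finset.range d, xD d D (d - s) * wtr w (n + 1) (rep D N hd hq (n + 1)
      (a * tGrp d (n + 1) (Fin.last n) ^ s)).val =
        d * (1 / (D.card : ℂ)) * wtr w (n + 1) (rep D N hd hq (n + 1) a).val := by
  simp only [wtr, Finset.mul_sum]
  rw [Finset.sum_comm]
  refine Finset.sum_congr rfl fun x _ => ?_
  have h : ∀ s, (rep D N hd hq (n + 1) (a * tGrp d (n + 1) (Fin.last n) ^ s)).val
      (Pi.single x 1) x = chi d (x (Fin.last n)).1 ^ s *
        (rep D N hd hq (n + 1) a).val (Pi.single x 1) x := by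
    intro s
    have : (opT (colourChar D) (n + 1) (Fin.last n) ^ s) (Pi.single x 1) =
        chi d (x (Fin.last n)).1 ^ s • (Pi.single x 1 : Word D N (n + 1) → ℂ) := by
      funext y
      rw [opT_pow_apply, Pi.smul_apply, smul_eq_mul]
      rcases eq_or_ne y x with rfl | h
      · simp
      · simp [Pi.single_eq_of_ne h]
    rw [map_mul, map_pow, Units.val_mul, Units.val_pow_eq_pow_val, rep_t, Module.End.mul_apply,
      this, map_smul, Pi.smul_apply, smul_eq_mul]
  simp only [h]
  rw [← sum_xD_mul_chi hd (x (Fin.last n)).1, Finset.sum_mul]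
  refine Finset.sum_congr rfl fun s _ => ?_
  ring

end RepTrace

/-! ### Interpolation in the parameters -/

/-- The geometric sum `1 + q⁻² + ⋯ + q^{-2(N-1)}`. -/
def qSum (q : ℝ) (N : ℕ) : ℝ := ∑ i ∈ Finset.range N, (q⁻¹ ^ 2) ^ i

theorem qSum_strictMono {q : ℝ} (hq : 0 < q) : StrictMono (qSum q) :=
  strictMono_nat_of_lt_succ fun N => by
    rw [qSum, qSum, Finset.sum_range_succ]
    exact lt_add_of_pos_right _ (by positivity)

theorem qSum_pos {q : ℝ} (hq : 0 < q) (N : ℕ) : 0 < qSum q (N + 1) := by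
  have := qSum_strictMono hq N.succ_pos
  simpa [qSum] using this

/-- The Markov parameter of the R-matrix with `N + 1` levels per colour and `m` colours. -/
def zParam (m : ℕ) (q : ℝ) (N : ℕ) : ℝ := q / (m * qSum q (N + 1))

theorem zParam_injective {m : ℕ} (hm : 1 ≤ m) {q : ℝ} (hq : 0 < q) :
    Function.Injective (zParam m q) := by
  intro N N' h
  have h1 := qSum_pos hq N
  have h2 := qSum_pos hq N'
  have hm' : (0 : ℝ) < m := by exact_mod_cast hm
  rw [zParam, zParam, div_eq_div_iff (by positivity) (by positivity)] at h
  have h3 := mul_left_cancel₀ hm'.ne' (mul_left_cancel₀ hq.ne' h)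
  have := (qSum_strictMono hq).injective h3
  omega

/-- The quadratic parameter `(q - q⁻¹) / d`. -/
def κParam (d : ℕ) (q : ℝ) : ℝ := (q - q⁻¹) / d

theorem κParam_injective {d : ℕ} (hd : 1 ≤ d) :
    Function.Injective fun Q : ℕ => κParam d (Q + 2) := by
  have hd' : (0 : ℝ) < d := by exact_mod_cast hd
  refine StrictMono.injective (strictMono_nat_of_lt_succ fun Q => ?_)
  rw [κParam, κParam]
  refine div_lt_div_of_pos_right (sub_lt_sub ?_ ?_) hd'
  · push_cast; linarith
  · exact inv_strictAnti₀ (by positivity) (by push_cast; linarith)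

/-- A polynomial in two variables is determined by its values at the parameters of the
R-matrices. -/
theorem eq_zero_of_evalEval {d m : ℕ} (hd : 1 ≤ d) (hm : 1 ≤ m) (p : ℂ[X][X])
    (h : ∀ Q N : ℕ, p.evalEval (κParam d (Q + 2) : ℂ) (zParam m (Q + 2) N : ℂ) = 0) : p = 0 := by
  -- for fixed `q` there are infinitely many values of `z`, and then infinitely many values of `q`
  have h1 : ∀ Q : ℕ, p.map (Polynomial.evalRingHom (κParam d (Q + 2) : ℂ)) = 0 := by
    intro Q
    refine Polynomial.eq_zero_of_infinite_isRoot _ (Set.Infinite.mono ?_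
      (Set.infinite_range_of_injective
        (Complex.ofReal_injective.comp (zParam_injective hm (q := (Q : ℝ) + 2) (by positivity)))))
    rintro _ ⟨N, rfl⟩
    rw [Set.mem_ofPred_eq, Polynomial.IsRoot, Function.comp_apply,
      Polynomial.map_evalRingHom_eval]
    exact h Q N
  ext1 k
  refine Polynomial.eq_zero_of_infinite_isRoot _ (Set.Infinite.mono ?_
    (Set.infinite_range_of_injective (Complex.ofReal_injective.comp (κParam_injective hd))))
  rintro _ ⟨Q, rfl⟩
  have := congrArg (fun p => Polynomial.coeff p k) (h1 Q)
  simpa using this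

/-- The Markov rule for the R-matrix in one colour: the sum telescopes and does not depend on the
level `i`. -/
theorem geometric_rDiag (q : ℂ) (hq : q ≠ 0) (i N : ℕ) (hi : i < N) :
    ∑ j ∈ Finset.range N, (q⁻¹ ^ 2) ^ j *
      (if i = j then q else if j < i then q - q⁻¹ else 0) = q := by
  have h1 : ∑ j ∈ Finset.range N, (q⁻¹ ^ 2) ^ j *
      (if i = j then q else if j < i then q - q⁻¹ else 0) =
      ∑ j ∈ Finset.range (i + 1), (q⁻¹ ^ 2) ^ j *
      (if i = j then q else if j < i then q - q⁻¹ else 0) := by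
    refine (Finset.sum_subset (Finset.range_mono hi) fun j _ hj => ?_).symm
    rw [Finset.mem_range] at hj
    rw [if_neg (by omega), if_neg (by omega), mul_zero]
  have h2 : ∀ i : ℕ, ∑ j ∈ Finset.range i, (q⁻¹ ^ 2) ^ j * (q - q⁻¹) + (q⁻¹ ^ 2) ^ i * q = q := by
    intro i
    induction i with
    | zero => simp
    | succ i ih =>
      rw [Finset.sum_range_succ]
      have : (q⁻¹ ^ 2) ^ (i + 1) * q = (q⁻¹ ^ 2) ^ i * q⁻¹ := by
        rw [pow_succ]; field_simp
      linear_combination ih + this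
  rw [h1, Finset.sum_range_succ, if_pos rfl, ← h2 i]
  congr 1
  · refine Finset.sum_congr rfl fun j hj => ?_
    rw [Finset.mem_range] at hj
    rw [if_neg (by omega), if_pos hj, h2]
  · rw [h2]

section Existence

variable {d : ℕ} {D : Finset (ZMod d)}

/-- The weights `q^{-2i} / (|D| (1 + q⁻² + ⋯ + q^{-2N}))` on the letters with levels `i ≤ N`. -/
def levelWeight (D : Finset (ZMod d)) (q : ℝ) (N : ℕ) (b : D × Fin (N + 1)) : ℂ :=
  ((D.card * qSum q (N + 1) : ℝ) : ℂ)⁻¹ * ((q : ℂ)⁻¹ ^ 2) ^ (b.2 : ℕ)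

theorem sum_levelWeight {q : ℝ} (hq : 0 < q) (N : ℕ) (c : D) :
    ∑ i, levelWeight D q N (c, i) = 1 / (D.card : ℂ) := by
  have h : ((qSum q (N + 1) : ℝ) : ℂ) ≠ 0 := by exact_mod_cast (qSum_pos hq N).ne'
  simp only [levelWeight, ← Finset.mul_sum]
  rw [Fin.sum_univ_eq_sum_range (fun i => ((q : ℂ)⁻¹ ^ 2) ^ i) (N + 1)]
  have h2 : ((qSum q (N + 1) : ℝ) : ℂ) = ∑ i ∈ Finset.range (N + 1), ((q : ℂ)⁻¹ ^ 2) ^ i := by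
    rw [qSum]; push_cast; rfl
  rw [← h2, Complex.ofReal_mul, Complex.ofReal_natCast, mul_inv, mul_assoc, inv_mul_cancel₀ h,
    mul_one, one_div]

theorem sum_levelWeight_rDiag {q : ℝ} (hq : 0 < q) (N : ℕ) (a : D × Fin (N + 1)) :
    ∑ b, levelWeight D q N b * rDiag (q : ℂ) a b = (zParam D.card q N : ℂ) := by
  have hq' : (q : ℂ) ≠ 0 := by exact_mod_cast hq.ne'
  rw [Fintype.sum_prod_type, Finset.sum_eq_single a.1]
  · have h := geometric_rDiag (q : ℂ) hq' a.2 (N + 1) a.2.2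
    rw [← Fin.sum_univ_eq_sum_range (fun j => ((q : ℂ)⁻¹ ^ 2) ^ j *
      (if (a.2 : ℕ) = j then (q : ℂ) else if j < a.2 then (q : ℂ) - (q : ℂ)⁻¹ else 0))] at h
    have h2 : ∀ i : Fin (N + 1), levelWeight D q N (a.1, i) * rDiag (q : ℂ) a (a.1, i) =
        ((D.card * qSum q (N + 1) : ℝ) : ℂ)⁻¹ * (((q : ℂ)⁻¹ ^ 2) ^ (i : ℕ) *
      (if (a.2 : ℕ) = i then (q : ℂ) else if (i : ℕ) < a.2 then (q : ℂ) - (q : ℂ)⁻¹ else 0)) := by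
      intro i
      rw [levelWeight, rDiag, mul_assoc]
      congr 2
      simp only [Prod.ext_iff, Fin.ext_iff, Fin.lt_def, true_and]
    rw [Finset.sum_congr rfl fun i _ => h2 i, ← Finset.mul_sum, h, zParam, Complex.ofReal_div,
      mul_comm, div_eq_mul_inv]
  · intro c _ hc
    refine Finset.sum_eq_zero fun i _ => ?_
    rw [rDiag_of_ne (fun h => hc h.symm), mul_zero]
  · simp

end Existence

/-! ### Existence of the specialized trace -/

namespace IsMarkovFunction

/-- Markov functions with values in a ring can be pushed forward along ring homomorphisms. -/
theorem map {R S : Type*} [CommRing R] [CommRing S] {d : ℕ} {κ z : R} {x : ℕ → R}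
    {T : ∀ n, FramedBraidGroup d n → R} (h : IsMarkovFunction d κ z x T) (φ : R →+* S) :
    IsMarkovFunction d (φ κ) (φ z) (fun k => φ (x k)) (fun n a => φ (T n a)) where
  compat n a := by rw [h.compat]
  trace n a b := by rw [h.trace]
  quad n i hi b := by
    rw [h.quad, map_add, smul_eq_mul, smul_eq_mul, map_mul, map_sum]
  markov n a := by rw [h.markov, smul_eq_mul, smul_eq_mul, map_mul]
  framing n a k := by rw [h.framing, smul_eq_mul, smul_eq_mul, map_mul]

/-- Markov functions can be pulled back along injective ring homomorphisms. -/
theorem of_map {R S : Type*} [CommRing R] [CommRing S] {d : ℕ} {κ z : R} {x : ℕ → R}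
    {T : ∀ n, FramedBraidGroup d n → R} (φ : R →+* S) (hφ : Function.Injective φ)
    (h : IsMarkovFunction d (φ κ) (φ z) (fun k => φ (x k)) (fun n a => φ (T n a))) :
    IsMarkovFunction d κ z x T where
  compat n a := hφ (h.compat n a)
  trace n a b := hφ (h.trace n a b)
  quad n i hi b := hφ (by
    have := h.quad n i hi b
    rwa [smul_eq_mul, ← map_sum, ← map_mul, ← map_add] at this)
  markov n a := hφ (by have := h.markov n a; rwa [smul_eq_mul, ← map_mul] at this)
  framing n a k := hφ (by have := h.framing n a k; rwa [smul_eq_mul, ← map_mul] at this)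

/-- If the parameters come from a ring `R`, then so do the values. -/
theorem exists_eq_map {R S : Type*} [CommRing R] [CommRing S] {d : ℕ} (hd : 1 ≤ d) (φ : R →+* S)
    {κ z : R} {x : ℕ → R} {T : ∀ n, FramedBraidGroup d n → S}
    (h : IsMarkovFunction d (φ κ) (φ z) (fun k => φ (x k)) T) (h1 : T 0 1 = 1) (n : ℕ)
    (a : FramedBraidGroup d n) : ∃ r, φ r = T n a := by
  let _ : Module R S := Module.compHom S φ
  have h' : IsMarkovFunction d κ z x T :=
    ⟨h.compat, h.trace, h.quad, h.markov, h.framing⟩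
  let L : Submodule R S :=
    { carrier := Set.range φ
      add_mem' := by rintro _ _ ⟨a, rfl⟩ ⟨b, rfl⟩; exact ⟨a + b, map_add _ _ _⟩
      zero_mem' := ⟨0, map_zero _⟩
      smul_mem' := by rintro r _ ⟨a, rfl⟩; exact ⟨r * a, map_mul _ _ _⟩ }
  exact h'.mem_of_one_mem hd L ⟨1, by rw [map_one, h1]⟩ n a

end IsMarkovFunction

/-- For every nonempty `D` there is a Markov function with values in `ℂ[z]` for the given quadratic
parameter. It is obtained from a Markov function over `ℂ[κ][z]` that interpolates the weighted
traces of all R-matrix representations. The last conjunct is the E-system identity. -/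
theorem exists_markovFunction {d : ℕ} (hd : 1 ≤ d) {D : Finset (ZMod d)} (hD : 1 ≤ D.card) (κ : ℂ) :
    ∃ T : ∀ n, FramedBraidGroup d n → ℂ[X],
      IsMarkovFunction d (Polynomial.C κ) Polynomial.X (fun k => Polynomial.C (xD d D k)) T ∧
      T 0 1 = 1 ∧
      ∀ n a, ∑ s ∈ Finset.range d, Polynomial.C (xD d D (d - s)) *
        T (n + 1) (a * tGrp d (n + 1) (Fin.last n) ^ s) =
          Polynomial.C (d * (1 / (D.card : ℂ))) * T (n + 1) a := by
  -- evaluation at the parameters of all R-matrices is injective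
  let Φ : ℂ[X][X] →+* (ℕ × ℕ → ℂ) := RingHom.pi fun p =>
    Polynomial.evalEvalRingHom (κParam d (p.1 + 2) : ℂ) (zParam D.card (p.1 + 2) p.2 : ℂ)
  have Φapp : ∀ r p, Φ r p =
      r.evalEval (κParam d (p.1 + 2) : ℂ) (zParam D.card (p.1 + 2) p.2 : ℂ) := fun _ _ => rfl
  have hΦ : Function.Injective Φ := by
    rw [injective_iff_map_eq_zero]
    intro r hr
    exact eq_zero_of_evalEval hd hD r fun Q N => congrFun hr (Q, N)
  have hq : ∀ Q : ℕ, (0 : ℝ) < Q + 2 := fun Q => by positivity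
  have hq' : ∀ Q : ℕ, (((Q : ℝ) + 2 : ℝ) : ℂ) ≠ 0 := fun Q => by exact_mod_cast (hq Q).ne'
  let T₀ : ∀ n, FramedBraidGroup d n → ℕ × ℕ → ℂ := fun n a p =>
    wtr (levelWeight D (p.1 + 2) p.2) n (rep D (p.2 + 1) hd (hq' p.1) n a).val
  have hT : ∀ p : ℕ × ℕ, IsMarkovFunction d (κParam d (p.1 + 2) : ℂ)
      (zParam D.card (p.1 + 2) p.2 : ℂ) (xD d D) (fun n a => T₀ n a p) := by
    intro p
    have := isMarkovFunction_wtr hd hD (hq' p.1) (levelWeight D (p.1 + 2) p.2)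
      (sum_levelWeight_rDiag (hq p.1) p.2) (sum_levelWeight (hq p.1) p.2)
    have hκ : (κParam d (p.1 + 2) : ℂ) =
        (((p.1 + 2 : ℝ) : ℂ) - ((p.1 + 2 : ℝ) : ℂ)⁻¹) / (d : ℂ) := by
      rw [κParam]; push_cast; rfl
    rw [hκ]
    exact this
  have hT₀ : IsMarkovFunction d (Φ (Polynomial.C Polynomial.X)) (Φ Polynomial.X)
      (fun k => Φ (Polynomial.C (Polynomial.C (xD d D k)))) T₀ := by
    refine ⟨fun n a => funext fun p => (hT p).compat n a,
      fun n a b => funext fun p => (hT p).trace n a b, fun n i hi b => funext fun p => ?_,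
      fun n a => funext fun p => ?_, fun n a k => funext fun p => ?_⟩
    · have := (hT p).quad n i hi b
      simpa [Φapp, Polynomial.evalEval_C] using this
    · have := (hT p).markov n a
      simpa [Φapp] using this
    · have := (hT p).framing n a k
      simpa [Φapp] using this
  have h1 : T₀ 0 1 = 1 := by
    funext p
    simp [T₀, wtr, wordWeight]
  choose P hP using hT₀.exists_eq_map hd Φ h1
  have hPM : IsMarkovFunction d (Polynomial.C Polynomial.X) Polynomial.X
      (fun k => Polynomial.C (Polynomial.C (xD d D k))) P := by
    refine IsMarkovFunction.of_map Φ hΦ ?_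
    simpa only [hP] using hT₀
  have hP1 : P 0 1 = 1 := hΦ (by rw [hP, h1, map_one])
  have hPE : ∀ n a, ∑ s ∈ Finset.range d, Polynomial.C (Polynomial.C (xD d D (d - s))) *
        P (n + 1) (a * tGrp d (n + 1) (Fin.last n) ^ s) =
          Polynomial.C (Polynomial.C (d * (1 / (D.card : ℂ)))) * P (n + 1) a := by
    intro n a
    refine hΦ ?_
    rw [map_sum, map_mul, hP]
    simp only [map_mul, hP]
    funext p
    have := wtr_idem hd (hq' p.1) (levelWeight D (p.1 + 2) p.2) n a
    simpa [Φapp, T₀] using this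
  -- specialization of the quadratic parameter
  let φ : ℂ[X][X] →+* ℂ[X] := Polynomial.mapRingHom (Polynomial.evalRingHom κ)
  refine ⟨fun n a => φ (P n a), ?_, by simp [hP1], fun n a => ?_⟩
  · have := hPM.map φ
    simpa [φ] using this
  · have := congrArg φ (hPE n a)
    simpa [φ] using this

/-! ### Specialized traces and Markov functions -/

theorem Y_induction {d n : ℕ} {q : ℂ} {p : Y d n q → Prop}
    (of : ∀ x, p (proj d n q (MonoidAlgebra.of ℂ _ x))) (add : ∀ a b, p a → p b → p (a + b))
    (smul : ∀ (k : ℂ) a, p a → p (k • a)) (a : Y d n q) : p a := by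
  obtain ⟨b, rfl⟩ := RingQuot.mkAlgHom_surjective ℂ (QuadRel d n q) a
  induction b using MonoidAlgebra.induction_on with
  | of x => exact of _
  | add x y hx hy => rw [map_add]; exact add _ _ hx hy
  | smul k x hx => rw [map_smul]; exact smul _ _ hx

/-- The image of an element of the framed braid group in `Y_{d,n}(q)`. -/
def toY (d n : ℕ) (q : ℂ) : FramedBraidGroup d n →* Y d n q :=
  ((proj d n q : FramedBraidAlgebra d n →* Y d n q)).comp (MonoidAlgebra.of ℂ _)

theorem toY_apply (d n : ℕ) (q : ℂ) (x : FramedBraidGroup d n) :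
    toY d n q x = proj d n q (MonoidAlgebra.of ℂ _ x) := rfl

theorem toY_σ (d n : ℕ) (q : ℂ) (i : ℕ) (hi : i + 1 < n) :
    toY d n q (σ d n i hi) = g d n q i hi := rfl

theorem toY_t (d n : ℕ) (q : ℂ) (j : Fin n) : toY d n q (tGrp d n j) = t d n q j := rfl

theorem incl_toY (d n : ℕ) (q : ℂ) (x : FramedBraidGroup d n) :
    incl d n q (toY d n q x) = toY d (n + 1) q (grpIncl d n x) := by
  rw [toY_apply, incl_proj, algIncl_of, toY_apply]

namespace IsSpecializedTrace

variable {d : ℕ} {q : ℂ} {D : Finset (ZMod d)} {T : ∀ n, Y d n q →ₗ[ℂ] ℂ[X]}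

/-- The framing rule for all exponents. -/
theorem framing_pow (hd : 1 ≤ d) (hD : 1 ≤ D.card) (h : IsSpecializedTrace d q D T) (n : ℕ)
    (a : Y d n q) (k : ℕ) : T (n + 1) (incl d n q a * t d (n + 1) q (Fin.last n) ^ k) =
      Polynomial.C (xD d D k) * T n a := by
  have ht : t d (n + 1) q (Fin.last n) ^ k = t d (n + 1) q (Fin.last n) ^ (k % d) := by
    conv_lhs => rw [← Nat.div_add_mod k d, pow_add, pow_mul, t_pow, one_pow, one_mul]
  rw [ht, ← xD_mod hd]
  rcases Nat.eq_zero_or_pos (k % d) with h0 | h0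
  · rw [h0, pow_zero, mul_one, h.compat, xD_zero hD, Polynomial.C_1, one_mul]
  · have := Nat.mod_lt k hd
    exact h.framing n _ _ h0 (by omega)

theorem isMarkovFunction (hd : 1 ≤ d) (hD : 1 ≤ D.card) (h : IsSpecializedTrace d q D T) :
    IsMarkovFunction d (Polynomial.C ((q - q⁻¹) / d) : ℂ[X]) (Polynomial.X : ℂ[X])
      (fun k => Polynomial.C (xD d D k)) (fun n a => T n (toY d n q a)) where
  compat n a := by rw [← incl_toY, h.compat]
  trace n a b := by rw [map_mul, h.trace, ← map_mul]
  quad n i hi b := by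
    have hg := g_sq d n q i hi
    rw [pow_two] at hg
    rw [map_mul (toY d n q), map_mul (toY d n q), toY_σ, hg, e_eq, add_mul, one_mul, smul_mul_assoc,
      smul_mul_assoc, smul_mul_assoc, smul_smul, map_add,
      map_smul, Finset.sum_mul, Finset.sum_mul, map_sum,
      mul_one_div, Polynomial.smul_eq_C_mul, smul_eq_mul]
    simp only [map_mul, map_pow, toY_σ, toY_t]
  markov n a := by rw [map_mul, ← incl_toY, toY_σ, h.markov, smul_eq_mul]
  framing n a k := by
    rw [map_mul, map_pow, ← incl_toY, toY_t, h.framing_pow hd hD, smul_eq_mul]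

theorem unique (hd : 1 ≤ d) (hD : 1 ≤ D.card) {T' : ∀ n, Y d n q →ₗ[ℂ] ℂ[X]}
    (h : IsSpecializedTrace d q D T) (h' : IsSpecializedTrace d q D T') : T = T' := by
  have hs := ((h.isMarkovFunction hd hD).sub (h'.isMarkovFunction hd hD)).mem_of_one_mem hd ⊥
    (by simp [h.one, h'.one])
  funext n
  refine LinearMap.ext fun a => ?_
  induction a using Y_induction with
  | of x => exact sub_eq_zero.1 (hs n x)
  | add a b ha hb => rw [map_add, map_add, ha, hb]
  | smul k a ha => rw [map_smul, map_smul, ha]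

end IsSpecializedTrace

/-- The specialized trace exists; moreover it has the E-system property
`tr(a e_n) = tr(a) / |D|`, in a form that does not mention `e_n`. -/
theorem exists_specializedTrace {d : ℕ} (hd : 1 ≤ d) (q : ℂ) {D : Finset (ZMod d)}
    (hD : 1 ≤ D.card) :
    ∃ T : ∀ n, Y d n q →ₗ[ℂ] ℂ[X], IsSpecializedTrace d q D T ∧
      ∀ n a, ∑ s ∈ Finset.range d, Polynomial.C (xD d D (d - s)) *
        T (n + 1) (a * t d (n + 1) q (Fin.last n) ^ s) =
          Polynomial.C (d * (1 / (D.card : ℂ))) * T (n + 1) a := by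
  obtain ⟨P, hP, hP1, hPE⟩ := exists_markovFunction hd hD ((q - q⁻¹) / d)
  have hlift : ∀ n, ∃ f : Y d n q →ₗ[ℂ] ℂ[X], ∀ a, f (toY d n q a) = P n a := by
    intro n
    obtain ⟨f, hf⟩ := exists_linear_lift (QuadRel d n q) (linExt ℂ (P n)) (by
      rintro _ _ ⟨i, hi⟩ u v
      induction u using MonoidAlgebra.induction_on with
      | of u =>
        induction v using MonoidAlgebra.induction_on with
        | of v =>
          simp only [eGrp, mul_add, add_mul, mul_one, mul_smul_comm, smul_mul_assoc, smul_smul,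
            Finset.mul_sum, Finset.sum_mul, map_add, map_smul, map_sum, ← map_mul, linExt_of,
            pow_two]
          have hcyc : ∀ y, P n (u * y * v) = P n (y * (v * u)) := by
            intro y
            rw [mul_assoc, hP.trace, mul_assoc]
          simp only [hcyc, hP.quad]
          rw [hP.trace n u v, mul_one_div, Polynomial.smul_eq_C_mul, smul_eq_mul]
        | add v w hv hw => simp only [mul_add, map_add] at hv hw ⊢; rw [hv, hw]
        | smul r v hv => simp only [mul_smul_comm, map_smul] at hv ⊢; rw [hv]
      | add u w hu hw =>
        rw [add_mul u w, add_mul u w, add_mul (u * _), add_mul (u * _), map_add, map_add, hu, hw]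
      | smul r u hu => simp only [smul_mul_assoc r u, smul_mul_assoc r (u * _), map_smul, hu])
    exact ⟨f, fun a => by rw [← linExt_of (R := ℂ) (P n) a, ← hf]; rfl⟩
  choose T hT using hlift
  have compat : ∀ n a, T (n + 1) (incl d n q a) = T n a := by
    intro n a
    induction a using Y_induction with
    | of a => rw [← toY_apply, incl_toY, hT, hT, hP.compat]
    | add a b ha hb => simp only [map_add, ha, hb]
    | smul r a ha => simp only [map_smul, ha]
  refine ⟨T, ⟨compat, ?_, ?_, ?_, ?_⟩, ?_⟩
  · intro n a b
    induction a using Y_induction with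
    | of a =>
      induction b using Y_induction with
      | of b => rw [← toY_apply, ← toY_apply, ← map_mul, ← map_mul, hT, hT, hP.trace]
      | add a b ha hb => simp only [map_add, add_mul, mul_add, ha, hb]
      | smul r a ha => simp only [map_smul, mul_smul_comm, smul_mul_assoc, ha]
    | add a b ha hb => simp only [map_add, add_mul, mul_add, ha, hb]
    | smul r a ha => simp only [map_smul, mul_smul_comm, smul_mul_assoc, ha]
  · intro n
    induction n with
    | zero => rw [← map_one (toY d 0 q), hT, hP1]
    | succ n ih => rw [← map_one (incl d n q), compat, ih]
  · intro n a
    induction a using Y_induction with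
    | of a =>
      rw [← toY_apply, incl_toY, ← toY_σ, ← map_mul, hT, hT, hP.markov, smul_eq_mul]
    | add a b ha hb => simp only [map_add, add_mul, mul_add, ha, hb]
    | smul r a ha => simp only [map_smul, smul_mul_assoc, ha, mul_smul_comm]
  · intro n a k _ _
    induction a using Y_induction with
    | of a =>
      rw [← toY_apply, incl_toY, ← toY_t, ← map_pow, ← map_mul, hT, hT, hP.framing, smul_eq_mul]
    | add a b ha hb => simp only [map_add, add_mul, mul_add, ha, hb]
    | smul r a ha => simp only [map_smul, smul_mul_assoc, ha, mul_smul_comm]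
  · intro n a
    induction a using Y_induction with
    | of a =>
      simp only [← toY_apply, ← toY_t, ← map_pow, ← map_mul (toY d (n + 1) q), hT]
      exact hPE n a
    | add a b ha hb => simp only [map_add, add_mul, mul_add, Finset.sum_add_distrib, ha, hb]
    | smul r a ha =>
      simp only [map_smul, smul_mul_assoc, mul_smul_comm, ← Finset.smul_sum, ha]

/-! ### The idempotents `e_{jk}` -/

section Ties

variable {d n : ℕ} {q : ℂ}

/-- The idempotent `e_{jk} = (1/d) ∑_s t_j^s t_k^{d-s}`. -/
def tie (d n : ℕ) (q : ℂ) (j k : Fin n) : Y d n q :=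
  (1 / (d : ℂ)) • ∑ s ∈ Finset.range d, t d n q j ^ s * t d n q k ^ (d - s)

theorem e_eq_tie (i : ℕ) (hi : i + 1 < n) :
    e d n q i hi = tie d n q ⟨i, by omega⟩ ⟨i + 1, hi⟩ := e_eq d n q i hi

theorem t_commute (j k : Fin n) : Commute (t d n q j) (t d n q k) := t_comm d n q j k

theorem t_commute_tie (l j k : Fin n) : Commute (t d n q l) (tie d n q j k) :=
  Commute.smul_right (Commute.sum_right _ _ _ fun _ _ =>
    ((t_commute l j).pow_right _).mul_right ((t_commute l k).pow_right _)) _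

theorem tie_commute (j k j' k' : Fin n) : Commute (tie d n q j k) (tie d n q j' k') :=
  Commute.smul_left (Commute.sum_left _ _ _ fun _ _ =>
    ((t_commute_tie j j' k').pow_left _).mul_left ((t_commute_tie k j' k').pow_left _)) _

/-- On the image of `e_{jk}` the generators `t_j` and `t_k` agree. -/
theorem t_mul_tie (j k : Fin n) : t d n q j * tie d n q j k = t d n q k * tie d n q j k := by
  have hxy := t_commute (d := d) (q := q) j k
  have hxd : t d n q j ^ d = 1 := t_pow d n q j
  have hyd : t d n q k ^ d = 1 := t_pow d n q k
  rw [tie, mul_smul_comm, mul_smul_comm, Finset.mul_sum, Finset.mul_sum]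
  congr 1
  generalize t d n q j = x at *
  generalize t d n q k = y at *
  have a1 : ∀ s ∈ Finset.range d,
      x * (x ^ s * y ^ (d - s)) = x ^ (s + 1) * y ^ (d + 1 - (s + 1)) := by
    intro s _
    rw [← mul_assoc, ← pow_succ', Nat.add_sub_add_right]
  have a2 : ∀ s ∈ Finset.range d, y * (x ^ s * y ^ (d - s)) = x ^ s * y ^ (d + 1 - s) := by
    intro s hs
    rw [← mul_assoc, (hxy.symm.pow_right s).eq, mul_assoc, ← pow_succ',
      Nat.sub_add_comm (Finset.mem_range.1 hs).le]
  rw [Finset.sum_congr rfl a1, Finset.sum_congr rfl a2]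
  -- both sums run over the terms of the same sum over `range (d + 1)`, whose end terms agree
  have b1 := Finset.sum_range_succ (fun s => x ^ s * y ^ (d + 1 - s)) d
  rw [Finset.sum_range_succ'] at b1
  simpa [hxd, hyd, pow_succ] using b1

theorem t_pow_mul_tie (j k : Fin n) (s : ℕ) :
    t d n q j ^ s * tie d n q j k = t d n q k ^ s * tie d n q j k := by
  induction s with
  | zero => simp
  | succ s ih =>
    rw [pow_succ, mul_assoc, t_mul_tie, ← mul_assoc, ← ((t_commute k j).pow_right s).eq, mul_assoc,
      ih, ← mul_assoc, ← pow_succ']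

theorem tie_symm (hd : 1 ≤ d) (j k : Fin n) : tie d n q j k = tie d n q k j := by
  have h : ∀ j k : Fin n, tie d n q k j * tie d n q j k = tie d n q j k := by
    intro j k
    conv_lhs => rw [tie]
    rw [smul_mul_assoc, Finset.sum_mul]
    have h3 : ∀ s ∈ Finset.range d,
        t d n q k ^ s * t d n q j ^ (d - s) * tie d n q j k = tie d n q j k := by
      intro s hs
      rw [mul_assoc, t_pow_mul_tie, ← mul_assoc, ← pow_add,
        Nat.add_sub_cancel' (Finset.mem_range.1 hs).le, t_pow, one_mul]
    rw [Finset.sum_congr rfl h3, Finset.sum_const, Finset.card_range, ← Nat.cast_smul_eq_nsmul ℂ,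
      smul_smul, one_div_mul_cancel (by exact_mod_cast (by omega : d ≠ 0)), one_smul]
  rw [← h j k, (tie_commute k j j k).eq, h k j]

/-- On the image of `e_{jk}` the idempotents `e_{kl}` and `e_{jl}` agree. -/
theorem tie_mul_tie (j k l : Fin n) :
    tie d n q k l * tie d n q j k = tie d n q j l * tie d n q j k := by
  rw [tie, tie.eq_1 d n q j l, smul_mul_assoc, smul_mul_assoc, Finset.sum_mul, Finset.sum_mul]
  congr 1
  refine Finset.sum_congr rfl fun s _ => ?_
  rw [((t_commute k l).pow_pow s _).eq, ((t_commute j l).pow_pow s _).eq, mul_assoc, mul_assoc,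
    t_pow_mul_tie]

theorem t_pow_mul_g (i : ℕ) (hi : i + 1 < n) (j : Fin n) (k : ℕ) :
    t d n q j ^ k * g d n q i hi = g d n q i hi * t d n q (adjSwap n i hi j) ^ k := by
  have := congrArg (toY d n q) (tGrp_pow_mul_σ d n i hi j k)
  simpa only [map_mul, map_pow, toY_σ, toY_t] using this

theorem tie_mul_g (i : ℕ) (hi : i + 1 < n) (j k : Fin n) :
    tie d n q j k * g d n q i hi =
      g d n q i hi * tie d n q (adjSwap n i hi j) (adjSwap n i hi k) := by
  rw [tie, tie, smul_mul_assoc, mul_smul_comm, Finset.sum_mul, Finset.mul_sum]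
  congr 1
  refine Finset.sum_congr rfl fun s _ => ?_
  rw [mul_assoc, t_pow_mul_g, ← mul_assoc, t_pow_mul_g, mul_assoc]

theorem incl_tie (j k : Fin n) :
    incl d n q (tie d n q j k) = tie d (n + 1) q j.castSucc k.castSucc := by
  simp only [tie, map_smul, map_sum, map_mul, map_pow, incl_t]

theorem e_commute_g (hd : 1 ≤ d) (i : ℕ) (hi : i + 1 < n) :
    Commute (e d n q i hi) (g d n q i hi) := by
  rw [Commute, SemiconjBy, e_eq_tie, tie_mul_g, adjSwap_left, adjSwap_right, tie_symm hd]

theorem g_commute_incl (d n : ℕ) (q : ℂ) (a : Y d n q) :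
    Commute (g d (n + 2) q n (by omega)) (incl d (n + 1) q (incl d n q a)) := by
  induction a using Y_induction with
  | of x =>
    rw [← toY_apply, incl_toY, incl_toY, ← toY_σ]
    exact (σ_last_commute d n x).map (toY d (n + 2) q)
  | add a b ha hb => rw [map_add, map_add]; exact ha.add_right hb
  | smul r a ha => rw [map_smul, map_smul]; exact ha.smul_right r

theorem t_last_commute_incl (d n : ℕ) (q : ℂ) (a : Y d n q) :
    Commute (t d (n + 1) q (Fin.last n)) (incl d n q a) := by
  induction a using Y_induction with
  | of x =>
    rw [← toY_apply, incl_toY, ← toY_t]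
    exact (tGrp_last_commute d n x).map (toY d (n + 1) q)
  | add a b ha hb => rw [map_add]; exact ha.add_right hb
  | smul r a ha => rw [map_smul]; exact ha.smul_right r

theorem e_commute_incl (d n : ℕ) (q : ℂ) (a : Y d n q) :
    Commute (e d (n + 2) q n (by omega)) (incl d (n + 1) q (incl d n q a)) := by
  have h1 : Commute (t d (n + 2) q ⟨n, by omega⟩) (incl d (n + 1) q (incl d n q a)) := by
    have := (t_last_commute_incl d n q a).map (incl d (n + 1) q)
    rwa [incl_t] at this
  have h2 : Commute (t d (n + 2) q ⟨n + 1, by omega⟩) (incl d (n + 1) q (incl d n q a)) :=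
    t_last_commute_incl d (n + 1) q _
  rw [e_eq]
  exact Commute.smul_left (Commute.sum_left _ _ _ fun _ _ =>
    (h1.pow_left _).mul_left (h2.pow_left _)) _

end Ties

/-! ### The subalgebra generated by the braiding generators is spanned by reduced words -/

section BrSpan

variable {d : ℕ} {q : ℂ}

/-- The element `(q - q⁻¹) e_i`. In contrast to `e_i` it lies in the subalgebra generated by the
braiding generators for all `q`. -/
def scaledE (d n : ℕ) (q : ℂ) (i : ℕ) (hi : i + 1 < n) : Y d n q := (q - q⁻¹) • e d n q i hi

theorem g_mul_g (n i : ℕ) (hi : i + 1 < n) :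
    g d n q i hi * g d n q i hi = 1 + scaledE d n q i hi * g d n q i hi := by
  rw [← pow_two, g_sq, scaledE, smul_mul_assoc]

theorem scaledE_mul_self (hd : 1 ≤ d) (n i : ℕ) (hi : i + 1 < n) :
    scaledE d n q i hi * scaledE d n q i hi = (q - q⁻¹) • scaledE d n q i hi := by
  rw [scaledE, smul_mul_smul_comm, e_idem hd, smul_smul]

theorem g_mul_scaledE (hd : 1 ≤ d) (n i : ℕ) (hi : i + 1 < n) :
    g d n q i hi * scaledE d n q i hi = scaledE d n q i hi * g d n q i hi :=
  ((e_commute_g hd i hi).smul_left _).eq.symm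

theorem scaledE_mul_g_mem (n i : ℕ) (hi : i + 1 < n) :
    scaledE d n q i hi * g d n q i hi ∈ br d n q := by
  have h := g_mul_g (d := d) (q := q) n i hi
  rw [← sub_eq_iff_eq_add'] at h
  rw [← h]
  exact sub_mem (mul_mem (g_mem_br _ _ _ _ _) (g_mem_br _ _ _ _ _)) (one_mem _)

theorem scaledE_mem (hd : 1 ≤ d) (n i : ℕ) (hi : i + 1 < n) : scaledE d n q i hi ∈ br d n q := by
  have h : scaledE d n q i hi = scaledE d n q i hi * g d n q i hi * g d n q i hi -
      (q - q⁻¹) • (scaledE d n q i hi * g d n q i hi) := by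
    rw [mul_assoc, g_mul_g, mul_add, mul_one, ← mul_assoc, scaledE_mul_self hd, smul_mul_assoc,
      add_sub_cancel_right]
  rw [h]
  exact sub_mem (mul_mem (scaledE_mul_g_mem _ _ _) (g_mem_br _ _ _ _ _))
    (Subalgebra.smul_mem _ (scaledE_mul_g_mem _ _ _) _)

/-- The letters `g_i`, `(q - q⁻¹) e_i`, `(q - q⁻¹) e_i g_i` of which a reduced word contains at most
one with the largest index. -/
inductive IsLetter (d n : ℕ) (q : ℂ) (i : ℕ) (hi : i + 1 < n) : Y d n q → Prop
  | braid : IsLetter d n q i hi (g d n q i hi)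
  | tie : IsLetter d n q i hi (scaledE d n q i hi)
  | tieBraid : IsLetter d n q i hi (scaledE d n q i hi * g d n q i hi)

theorem IsLetter.mem_br (hd : 1 ≤ d) {n i : ℕ} {hi : i + 1 < n} {x : Y d n q}
    (hx : IsLetter d n q i hi x) : x ∈ br d n q := by
  cases hx with
  | braid => exact g_mem_br _ _ _ _ _
  | tie => exact scaledE_mem hd _ _ _
  | tieBraid => exact scaledE_mul_g_mem _ _ _

theorem IsLetter.commute {n : ℕ} {x : Y d (n + 2) q}
    (hx : IsLetter d (n + 2) q n (by omega) x) (a : Y d n q) :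
    Commute x (incl d (n + 1) q (incl d n q a)) := by
  have hg := g_commute_incl d n q a
  have he : Commute (scaledE d (n + 2) q n (by omega)) (incl d (n + 1) q (incl d n q a)) :=
    (e_commute_incl d n q a).smul_left _
  cases hx with
  | braid => exact hg
  | tie => exact he
  | tieBraid => exact he.mul_left hg

/-- The span of the elements `a` and `a x b` with `a`, `b` in `Y_{d,n}(q)^{(br)}` and `x` a letter
with the largest possible index. -/
def brSpan (d n : ℕ) (q : ℂ) : Submodule ℂ (Y d (n + 1) q) :=
  Submodule.span ℂ ({y | ∃ a ∈ br d n q, y = incl d n q a} ∪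
    {y | ∃ a ∈ br d n q, ∃ b ∈ br d n q, ∃ (i : ℕ) (hi : i + 1 = n), ∃ x,
      IsLetter d (n + 1) q i (by omega) x ∧ y = incl d n q a * x * incl d n q b})

theorem incl_mem_brSpan {n : ℕ} {a : Y d n q} (ha : a ∈ br d n q) :
    incl d n q a ∈ brSpan d n q :=
  Submodule.subset_span (Or.inl ⟨a, ha, rfl⟩)

theorem letter_mem_brSpan {n : ℕ} {a b : Y d n q} (ha : a ∈ br d n q) (hb : b ∈ br d n q)
    (i : ℕ) (hi : i + 1 = n) {x : Y d (n + 1) q} (hx : IsLetter d (n + 1) q i (by omega) x) :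
    incl d n q a * x * incl d n q b ∈ brSpan d n q :=
  Submodule.subset_span (Or.inr ⟨a, ha, b, hb, i, hi, x, hx, rfl⟩)

theorem incl_mul_mem_brSpan {n : ℕ} {c : Y d n q} (hc : c ∈ br d n q) {u : Y d (n + 1) q}
    (hu : u ∈ brSpan d n q) : incl d n q c * u ∈ brSpan d n q := by
  induction hu using Submodule.span_induction with
  | mem y hy =>
    rcases hy with ⟨a, ha, rfl⟩ | ⟨a, ha, b, hb, i, hi, x, hx, rfl⟩
    · rw [← map_mul]; exact incl_mem_brSpan (mul_mem hc ha)
    · rw [← mul_assoc, ← mul_assoc, ← map_mul]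
      exact letter_mem_brSpan (mul_mem hc ha) hb i hi hx
  | zero => simp
  | add x y _ _ hx hy => rw [mul_add]; exact add_mem hx hy
  | smul k x _ hx => rw [mul_smul_comm]; exact Submodule.smul_mem _ _ hx

theorem mul_incl_mem_brSpan {n : ℕ} {c : Y d n q} (hc : c ∈ br d n q) {u : Y d (n + 1) q}
    (hu : u ∈ brSpan d n q) : u * incl d n q c ∈ brSpan d n q := by
  induction hu using Submodule.span_induction with
  | mem y hy =>
    rcases hy with ⟨a, ha, rfl⟩ | ⟨a, ha, b, hb, i, hi, x, hx, rfl⟩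
    · rw [← map_mul]; exact incl_mem_brSpan (mul_mem ha hc)
    · rw [mul_assoc, ← map_mul]
      exact letter_mem_brSpan ha (mul_mem hb hc) i hi hx
  | zero => simp
  | add x y _ _ hx hy => rw [add_mul]; exact add_mem hx hy
  | smul k x _ hx => rw [smul_mul_assoc]; exact Submodule.smul_mem _ _ hx

/-- Reduction of a word `g x' x` with letters `x'` of index `i` and `x` of index `i + 1`. With `K`,
`K'` the scaled idempotents of indices `i + 1`, `i` and `F` the one for the strands `i` and `i + 2`,
all nine products follow from the braid relation, from the rules for moving `K`, `K'`, `F` through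
the braiding generators, and from the fact that any two different ones among `K`, `K'`, `F` have the
same product. -/
theorem g_mul_letter_mul_letter_mem (hd : 1 ≤ d) (i : ℕ) {x' : Y d (i + 2) q}
    (hx' : IsLetter d (i + 2) q i (by omega) x') {x : Y d (i + 3) q}
    (hx : IsLetter d (i + 3) q (i + 1) (by omega) x) :
    g d (i + 3) q (i + 1) (by omega) * incl d (i + 2) q x' * x ∈ brSpan d (i + 2) q := by
  set G := g d (i + 3) q (i + 1) (by omega) with hG
  set G' := g d (i + 3) q i (by omega) with hG'
  set K := scaledE d (i + 3) q (i + 1) (by omega) with hK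
  set K' := scaledE d (i + 3) q i (by omega) with hK'
  set F := (q - q⁻¹) • tie d (i + 3) q ⟨i, by omega⟩ ⟨i + 2, by omega⟩ with hF
  -- the images of the letters of index `i`
  have iG : incl d (i + 2) q (g d (i + 2) q i (by omega)) = G' := incl_g ..
  have iK : incl d (i + 2) q (scaledE d (i + 2) q i (by omega)) = K' := by
    rw [scaledE, map_smul, e_eq_tie, incl_tie, hK', scaledE, e_eq_tie]
    rfl
  have mG : g d (i + 2) q i (by omega) ∈ br d (i + 2) q := g_mem_br _ _ _ _ _
  have mK : scaledE d (i + 2) q i (by omega) ∈ br d (i + 2) q := scaledE_mem hd _ _ _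
  -- relations
  have s1 := adjSwap_left (i + 3) i (by omega)
  have s2 := adjSwap_right (i + 3) i (by omega)
  have s3 := adjSwap_of_ne (i + 3) i (by omega) ⟨i + 2, by omega⟩ (by simp) (by simp)
  have s4 := adjSwap_left (i + 3) (i + 1) (by omega)
  have s5 := adjSwap_right (i + 3) (i + 1) (by omega)
  have s6 := adjSwap_of_ne (i + 3) (i + 1) (by omega) ⟨i, by omega⟩ (by simp) (by simp; omega)
  have rb : G * G' * G = G' * G * G' := by
    have := congrArg (toY d (i + 3) q) (σ_braid d (i + 3) i (by omega))
    simpa only [map_mul, toY_σ] using this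
  have rG : G * G = 1 + K * G := g_mul_g ..
  have rG' : G' * G' = 1 + K' * G' := g_mul_g ..
  have cK : G * K = K * G := g_mul_scaledE hd ..
  have cK' : G' * K' = K' * G' := g_mul_scaledE hd ..
  have KK : K * K = (q - q⁻¹) • K := scaledE_mul_self hd ..
  have gK' : G * K' = F * G := by
    rw [hK', scaledE, hF, e_eq_tie, smul_mul_assoc, mul_smul_comm, tie_mul_g, s6, s5]
  have g'K : G' * K = F * G' := by
    rw [hK, scaledE, hF, e_eq_tie, smul_mul_assoc, mul_smul_comm, tie_mul_g, s1, s3]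
  have gF : G * F = K' * G := by
    rw [hK', scaledE, hF, e_eq_tie, smul_mul_assoc, mul_smul_comm, tie_mul_g, s6, s4]
  have g'F : G' * F = K * G' := by
    rw [hK, scaledE, hF, e_eq_tie, smul_mul_assoc, mul_smul_comm, tie_mul_g, s2, s3]
  have KK' : K * K' = K' * K := by
    rw [hK, hK', scaledE, scaledE, e_eq_tie, e_eq_tie]
    exact (((tie_commute _ _ _ _).smul_left _).smul_right _).eq
  have FK' : F * K' = K' * K := by
    rw [← KK', hK, hK', hF, scaledE, scaledE, smul_mul_smul_comm, smul_mul_smul_comm, e_eq_tie,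
      e_eq_tie, tie_mul_tie]
  have K'F : K' * F = K' * K := by
    rw [← FK', hK', hF, scaledE, e_eq_tie]
    exact (((tie_commute _ _ _ _).smul_left _).smul_right _).eq
  have FK : F * K = K' * K := by
    rw [hK, hK', hF, scaledE, scaledE, smul_mul_smul_comm, smul_mul_smul_comm, e_eq_tie,
      e_eq_tie, tie_symm hd ⟨i + 1, _⟩, tie_symm hd ⟨i, _⟩ ⟨i + 2, _⟩,
      tie_symm hd ⟨i, _⟩ ⟨i + 1, _⟩, ← tie_mul_tie, tie_symm hd ⟨i + 1, _⟩]
  have rb' : G * (G' * G) = G' * (G * G') := by rw [← mul_assoc, rb, mul_assoc]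
  -- `G' - K'` is the inverse of `G'`
  have FG' : F = G' * K * (G' - K') := by
    rw [g'K, mul_assoc, mul_sub, rG', cK', add_sub_cancel_right, mul_one]
  have GG'K : G * G' * K = K' * G * G' := by rw [mul_assoc, g'K, ← mul_assoc, gF]
  -- membership of the reduced words
  have mem : ∀ {a b : Y d (i + 2) q} {x : Y d (i + 3) q}, a ∈ br d (i + 2) q →
      b ∈ br d (i + 2) q → IsLetter d (i + 3) q (i + 1) (by omega) x →
      incl d (i + 2) q a * x * incl d (i + 2) q b ∈ brSpan d (i + 2) q :=
    fun ha hb hx => letter_mem_brSpan ha hb (i + 1) rfl hx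
  have one : (1 : Y d (i + 2) q) ∈ br d (i + 2) q := one_mem _
  have one' := map_one (incl d (i + 2) q)
  have hK'KG : K' * (K * G) ∈ brSpan d (i + 2) q := by
    have := mem mK one .tieBraid
    rwa [iK, one', mul_one] at this
  cases hx' with
  | braid =>
    rw [iG]
    cases hx with
    | braid =>
      rw [rb, ← iG]
      exact mem mG mG .braid
    | tie =>
      rw [GG'K, ← iK, ← iG]
      exact mem mK mG .braid
    | tieBraid =>
      have : G * G' * (K * G) = K' * G' * G * G' := by
        rw [← mul_assoc, GG'K]
        simp only [mul_assoc]
        rw [rb']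
      rw [this, ← iK, ← iG, ← map_mul]
      exact mem (mul_mem mK mG) mG .braid
  | tie =>
    rw [iK]
    cases hx with
    | braid =>
      have : G * K' * G = G' * K * (G' - K') + K' * (K * G) := by
        rw [← FG', gK', mul_assoc, rG, mul_add, mul_one, ← mul_assoc F, FK, mul_assoc]
      rw [this, ← iG, ← iK, ← map_sub, iK]
      exact add_mem (mem mG (sub_mem mG mK) .tie) hK'KG
    | tie =>
      have : G * K' * K = K' * (K * G) := by
        rw [gK', mul_assoc, cK, ← mul_assoc, FK, mul_assoc]
      rw [this]
      exact hK'KG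
    | tieBraid =>
      have : G * K' * (K * G) = K' * K + (q - q⁻¹) • (K' * (K * G)) := by
        rw [← mul_assoc, gK', mul_assoc F, cK, ← mul_assoc F, FK, mul_assoc, mul_assoc, rG,
          mul_add, mul_one, ← mul_assoc K K, KK, mul_add, smul_mul_assoc, mul_smul_comm]
      rw [this]
      refine add_mem ?_ (Submodule.smul_mem _ _ hK'KG)
      have := mem mK one .tie
      rwa [iK, one', mul_one] at this
  | tieBraid =>
    rw [map_mul, iK, iG]
    have h8 : G * (K' * G') * K = K' * (K * G) * G' := by
      have : G * (K' * G') * K = F * (G * G' * K) := by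
        rw [← mul_assoc, gK']
        simp only [mul_assoc]
      rw [this, GG'K, mul_assoc K', ← mul_assoc F, FK']
      simp only [mul_assoc]
    cases hx with
    | braid =>
      have : G * (K' * G') * G = G' * (K * G) * G' := by
        rw [← mul_assoc, gK', mul_assoc, mul_assoc, rb', ← mul_assoc F, ← g'K]
        simp only [mul_assoc]
      rw [this, ← iG]
      exact mem mG mG .tieBraid
    | tie =>
      rw [h8, ← iK, ← iG]
      exact mem mK mG .tieBraid
    | tieBraid =>
      have : G * (K' * G') * (K * G) = G' * K' * (K * G) * G' := by
        rw [← mul_assoc, h8]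
        calc K' * (K * G) * G' * G = K' * K * (G * (G' * G)) := by simp only [mul_assoc]
          _ = K' * (K * G') * (G * G') := by rw [rb']; simp only [mul_assoc]
          _ = K' * G' * F * (G * G') := by rw [← g'F]; simp only [mul_assoc]
          _ = G' * (K' * F) * (G * G') := by rw [← cK']; simp only [mul_assoc]
          _ = G' * K' * (K * G) * G' := by rw [K'F]; simp only [mul_assoc]
      rw [this, ← iG, ← iK, ← map_mul]
      exact mem (mul_mem mG mK) mG .tieBraid

theorem g_mul_letter_mem (hd : 1 ≤ d) (i : ℕ) {x : Y d (i + 2) q}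
    (hx : IsLetter d (i + 2) q i (by omega) x) :
    g d (i + 2) q i (by omega) * x ∈ brSpan d (i + 1) q := by
  have mem : ∀ {x}, IsLetter d (i + 2) q i (by omega) x → x ∈ brSpan d (i + 1) q := by
    intro x hx
    simpa using letter_mem_brSpan (one_mem (br d (i + 1) q)) (one_mem _) i rfl hx
  have one : (1 : Y d (i + 2) q) ∈ brSpan d (i + 1) q := by
    simpa using incl_mem_brSpan (one_mem (br d (i + 1) q))
  cases hx with
  | braid => rw [g_mul_g]; exact add_mem one (mem .tieBraid)
  | tie => rw [g_mul_scaledE hd]; exact mem .tieBraid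
  | tieBraid =>
    rw [← mul_assoc, g_mul_scaledE hd, mul_assoc, g_mul_g, mul_add, mul_one, ← mul_assoc,
      scaledE_mul_self hd, smul_mul_assoc]
    exact add_mem (mem .tie) (Submodule.smul_mem _ _ (mem .tieBraid))

theorem br_zero {a : Y d 0 q} (ha : a ∈ br d 0 q) : ∃ c : ℂ, a = c • 1 := by
  have h : {x | ∃ (i : ℕ) (hi : i + 1 < 0), x = g d 0 q i hi} = ∅ := by
    refine Set.eq_empty_of_forall_notMem ?_
    rintro x ⟨i, hi, _⟩
    omega
  rw [br, h, Algebra.adjoin_empty, Algebra.mem_bot] at ha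
  obtain ⟨c, rfl⟩ := ha
  exact ⟨c, Algebra.algebraMap_eq_smul_one c⟩

/-- Every element is a combination of reduced words, provided that this holds for the words in which
two letters of the largest index occur, the first one being the braiding generator. -/
theorem mem_brSpan_of (n : ℕ) (h : ∀ (i : ℕ) (hi : i + 1 = n), ∀ a ∈ br d n q, ∀ x,
      IsLetter d (n + 1) q i (by omega) x →
        g d (n + 1) q i (by omega) * incl d n q a * x ∈ brSpan d n q)
    {a : Y d (n + 1) q} (ha : a ∈ br d (n + 1) q) : a ∈ brSpan d n q := by
  have key : ∀ u ∈ brSpan d n q, a * u ∈ brSpan d n q := by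
    induction ha using Algebra.adjoin_induction with
    | mem y hy =>
      obtain ⟨i, hi, rfl⟩ := hy
      intro u hu
      by_cases hin : i + 1 < n
      · rw [← incl_g d n q i hin]
        exact incl_mul_mem_brSpan (g_mem_br _ _ _ _ _) hu
      obtain rfl : n = i + 1 := by omega
      induction hu using Submodule.span_induction with
      | mem y hy =>
        rcases hy with ⟨a, ha, rfl⟩ | ⟨a, ha, b, hb, i', hi', x, hx, rfl⟩
        · simpa using letter_mem_brSpan (one_mem _) ha i rfl IsLetter.braid
        · obtain rfl : i' = i := by omega
          rw [← mul_assoc, ← mul_assoc]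
          exact mul_incl_mem_brSpan hb (h i' rfl a ha x hx)
      | zero => simp
      | add x y _ _ hx hy => rw [mul_add]; exact add_mem hx hy
      | smul k x _ hx => rw [mul_smul_comm]; exact Submodule.smul_mem _ _ hx
    | algebraMap c =>
      intro u hu
      rw [← Algebra.smul_def]
      exact Submodule.smul_mem _ _ hu
    | add x y _ _ hx hy => intro u hu; rw [add_mul]; exact add_mem (hx u hu) (hy u hu)
    | mul x y _ _ hx hy => intro u hu; rw [mul_assoc]; exact hx _ (hy u hu)
  simpa using key 1 (by simpa using incl_mem_brSpan (one_mem (br d n q)))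

/-- Every element of `Y_{d,n+1}(q)^{(br)}` is a linear combination of reduced words. -/
theorem mem_brSpan (hd : 1 ≤ d) (n : ℕ) {a : Y d (n + 1) q} (ha : a ∈ br d (n + 1) q) :
    a ∈ brSpan d n q := by
  induction n with
  | zero => exact mem_brSpan_of 0 (fun i hi => by omega) ha
  | succ n ih =>
    refine mem_brSpan_of (n + 1) (fun i hi b hb x hx => ?_) ha
    obtain rfl : i = n := by omega
    have hb' := ih hb
    clear hb
    induction hb' using Submodule.span_induction with
    | mem y hy =>
      rcases hy with ⟨a', ha', rfl⟩ | ⟨a', ha', b', hb', i', rfl, x', hx', rfl⟩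
      · rw [(g_commute_incl d i q a').eq, mul_assoc]
        exact incl_mul_mem_brSpan (incl_mem_br d i q ⟨a', ha'⟩) (g_mul_letter_mem hd i hx)
      · have hgc := (g_commute_incl d (i' + 1) q a').eq
        have hxc := (hx.commute b').eq
        have : g d (i' + 1 + 1 + 1) q (i' + 1) (by omega) *
            incl d (i' + 1 + 1) q (incl d (i' + 1) q a' * x' * incl d (i' + 1) q b') * x =
            incl d (i' + 1 + 1) q (incl d (i' + 1) q a') *
              (g d (i' + 1 + 1 + 1) q (i' + 1) (by omega) * incl d (i' + 1 + 1) q x' * x) *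
              incl d (i' + 1 + 1) q (incl d (i' + 1) q b') := by
          rw [map_mul, map_mul]
          simp only [← mul_assoc]
          rw [hgc]
          simp only [mul_assoc]
          rw [hxc]
        rw [this]
        exact mul_incl_mem_brSpan (incl_mem_br d _ q ⟨b', hb'⟩)
          (incl_mul_mem_brSpan (incl_mem_br d _ q ⟨a', ha'⟩)
            (g_mul_letter_mul_letter_mem hd i' hx' hx))
    | zero => simp
    | add u v _ _ hu hv =>
      rw [map_add, mul_add, add_mul]
      exact add_mem hu hv
    | smul k u _ hu =>
      rw [map_smul, mul_smul_comm, smul_mul_assoc]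
      exact Submodule.smul_mem _ _ hu

end BrSpan

/-! ### The trace on the subalgebra generated by the braiding generators -/

section BraidTrace

variable {d : ℕ} {q : ℂ}

/-- The rules (iii)--(v) determine the effect of removing a letter with the largest index. -/
theorem IsLetter.exists_factor (hd : 1 ≤ d) {m n : ℕ} {x : Y d (n + 2) q}
    (hx : IsLetter d (n + 2) q n (by omega) x) : ∃ r : ℂ[X],
      ∀ τ : ∀ n : ℕ, br d n q →ₗ[ℂ] ℂ[X], IsBraidTrace d q m τ → ∀ a : br d (n + 1) q,
        τ (n + 2) (brIncl d (n + 1) q a * ⟨x, hx.mem_br hd⟩) = r * τ (n + 1) a := by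
  -- if `q - q⁻¹ = 0`, the scaled idempotent vanishes, otherwise `e_n` lies in the subalgebra
  by_cases hc : q - q⁻¹ = 0
  · have h0 : scaledE d (n + 2) q n (by omega) = 0 := by rw [scaledE, hc, zero_smul]
    cases hx with
    | braid => exact ⟨Polynomial.X, fun τ hτ a => hτ.markov n a⟩
    | tie =>
      refine ⟨0, fun τ hτ a => ?_⟩
      have : (⟨scaledE d (n + 2) q n (by omega), scaledE_mem hd _ _ _⟩ : br d (n + 2) q) = 0 :=
        Subtype.ext h0
      rw [this, mul_zero, map_zero, zero_mul]
    | tieBraid =>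
      refine ⟨0, fun τ hτ a => ?_⟩
      have : (⟨scaledE d (n + 2) q n (by omega) * g d (n + 2) q n (by omega),
          scaledE_mul_g_mem _ _ _⟩ : br d (n + 2) q) = 0 :=
        Subtype.ext ((congrArg (· * g d (n + 2) q n (by omega)) h0).trans (zero_mul _))
      rw [this, mul_zero, map_zero, zero_mul]
  · have he : e d (n + 2) q n (by omega) ∈ br d (n + 2) q := by
      have := Subalgebra.smul_mem _ (scaledE_mem (q := q) hd (n + 2) n (by omega)) (q - q⁻¹)⁻¹
      rwa [scaledE, smul_smul, inv_mul_cancel₀ hc, one_smul] at this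
    cases hx with
    | braid => exact ⟨Polynomial.X, fun τ hτ a => hτ.markov n a⟩
    | tie =>
      refine ⟨Polynomial.C (q - q⁻¹) * Polynomial.C (1 / (m : ℂ)), fun τ hτ a => ?_⟩
      have : (⟨scaledE d (n + 2) q n (by omega), scaledE_mem hd _ _ _⟩ : br d (n + 2) q) =
        (q - q⁻¹) • ⟨e d (n + 2) q n (by omega), he⟩ := rfl
      rw [this, mul_smul_comm, map_smul, hτ.idem, Polynomial.smul_eq_C_mul, mul_assoc]
    | tieBraid =>
      refine ⟨Polynomial.C (q - q⁻¹) * Polynomial.X, fun τ hτ a => ?_⟩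
      have : (⟨scaledE d (n + 2) q n (by omega) * g d (n + 2) q n (by omega),
          scaledE_mul_g_mem _ _ _⟩ : br d (n + 2) q) =
        (q - q⁻¹) • (⟨e d (n + 2) q n (by omega), he⟩ * brG d (n + 2) q n (by omega)) :=
        Subtype.ext (smul_mul_assoc _ _ _)
      rw [this, mul_smul_comm, map_smul, ← mul_assoc, hτ.idem_markov, Polynomial.smul_eq_C_mul,
        mul_assoc]

/-- The rules (i)--(v) determine the trace on the subalgebra generated by the braiding
generators. -/
theorem IsBraidTrace.unique (hd : 1 ≤ d) {m : ℕ} {τ τ' : ∀ n : ℕ, br d n q →ₗ[ℂ] ℂ[X]}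
    (h : IsBraidTrace d q m τ) (h' : IsBraidTrace d q m τ') : τ = τ' := by
  have key : ∀ n (a : br d n q), τ n a = τ' n a := by
    intro n
    induction n with
    | zero =>
      rintro ⟨a, ha⟩
      obtain ⟨c, rfl⟩ := br_zero ha
      have : (⟨c • 1, ha⟩ : br d 0 q) = c • 1 := rfl
      rw [this, map_smul, map_smul, h.one, h'.one]
    | succ n ih =>
      rintro ⟨a, ha⟩
      have hs : ∃ hy : a ∈ br d (n + 1) q, τ (n + 1) ⟨a, hy⟩ = τ' (n + 1) ⟨a, hy⟩ := by
        have ha' := mem_brSpan hd n ha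
        clear ha
        induction ha' using Submodule.span_induction with
        | mem y hy =>
          rcases hy with ⟨a, ha, rfl⟩ | ⟨a, ha, b, hb, i, rfl, x, hx, rfl⟩
          · refine ⟨incl_mem_br d n q ⟨a, ha⟩, ?_⟩
            exact ((h.compat n ⟨a, ha⟩).trans (ih _)).trans (h'.compat n ⟨a, ha⟩).symm
          · obtain ⟨r, hr⟩ := hx.exists_factor hd (m := m)
            have hval : ∀ σ : ∀ n : ℕ, br d n q →ₗ[ℂ] ℂ[X], IsBraidTrace d q m σ →
                σ (i + 2) (brIncl d (i + 1) q ⟨a, ha⟩ * ⟨x, hx.mem_br hd⟩ *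
                  brIncl d (i + 1) q ⟨b, hb⟩) = r * σ (i + 1) (⟨b, hb⟩ * ⟨a, ha⟩) := by
              intro σ hσ
              rw [hσ.trace, ← mul_assoc, ← hr σ hσ]
              congr 2
              exact Subtype.ext (map_mul (incl d (i + 1) q) b a).symm
            exact ⟨_, ((hval τ h).trans (by rw [ih])).trans (hval τ' h').symm⟩
        | zero => exact ⟨zero_mem _, (map_zero (τ (n + 1))).trans (map_zero (τ' (n + 1))).symm⟩
        | add u v _ _ hu hv =>
          obtain ⟨hu, eu⟩ := hu
          obtain ⟨hv, ev⟩ := hv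
          refine ⟨add_mem hu hv, ?_⟩
          have : (⟨u + v, add_mem hu hv⟩ : br d (n + 1) q) = ⟨u, hu⟩ + ⟨v, hv⟩ := rfl
          rw [this, map_add, map_add, eu, ev]
        | smul k u _ hu =>
          obtain ⟨hu, eu⟩ := hu
          refine ⟨Subalgebra.smul_mem _ hu k, ?_⟩
          have : (⟨k • u, Subalgebra.smul_mem _ hu k⟩ : br d (n + 1) q) = k • ⟨u, hu⟩ := rfl
          rw [this, map_smul, map_smul, eu]
      exact hs.2
  funext n
  exact LinearMap.ext (key n)

/-- The rule (v) holds for the specialized trace because `e_n g_n` is the average of the conjugates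
`t_n^s g_n t_n^{-s}`. -/
theorem IsSpecializedTrace.idem_markov (hd : 1 ≤ d) {D : Finset (ZMod d)}
    {T : ∀ n, Y d n q →ₗ[ℂ] ℂ[X]} (h : IsSpecializedTrace d q D T) (n : ℕ) (a : Y d (n + 1) q) :
    T (n + 2) (incl d (n + 1) q a * e d (n + 2) q n (by omega) * g d (n + 2) q n (by omega)) =
      Polynomial.X * T (n + 1) a := by
  have hterm : ∀ s ∈ Finset.range d, T (n + 2) (incl d (n + 1) q a *
      (t d (n + 2) q ⟨n, by omega⟩ ^ s * t d (n + 2) q ⟨n + 1, by omega⟩ ^ (d - s)) *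
        g d (n + 2) q n (by omega)) = Polynomial.X * T (n + 1) a := by
    intro s hs
    have h1 : incl d (n + 1) q a *
      (t d (n + 2) q ⟨n, by omega⟩ ^ s * t d (n + 2) q ⟨n + 1, by omega⟩ ^ (d - s)) *
        g d (n + 2) q n (by omega) = incl d (n + 1) q (a * t d (n + 1) q (Fin.last n) ^ s) *
          g d (n + 2) q n (by omega) * incl d (n + 1) q (t d (n + 1) q (Fin.last n) ^ (d - s)) := by
      rw [map_mul, map_pow, map_pow, incl_t, mul_assoc, mul_assoc (_ ^ s), t_pow_mul_g,
        adjSwap_right]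
      simp only [mul_assoc]
      rfl
    rw [h1, h.trace, ← mul_assoc, ← map_mul, h.markov, h.trace, mul_assoc, ← pow_add,
      Nat.add_sub_cancel' (Finset.mem_range.1 hs).le, t_pow, mul_one]
  rw [e_eq, mul_smul_comm, smul_mul_assoc, map_smul, Finset.mul_sum, Finset.sum_mul, map_sum,
    Finset.sum_congr rfl hterm, Finset.sum_const, Finset.card_range, ← Nat.cast_smul_eq_nsmul ℂ,
    smul_smul, one_div_mul_cancel (by exact_mod_cast (by omega : d ≠ 0)), one_smul]

/-- The restriction of the specialized trace satisfies the rules (i)--(v). -/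
theorem IsSpecializedTrace.isBraidTrace (hd : 1 ≤ d) {D : Finset (ZMod d)} (hD : 1 ≤ D.card)
    {T : ∀ n, Y d n q →ₗ[ℂ] ℂ[X]} (h : IsSpecializedTrace d q D T) :
    IsBraidTrace d q D.card (fun n => (T n).comp (br d n q).val.toLinearMap) where
  compat n a := h.compat n a
  trace n a b := h.trace n a b
  one n := h.one n
  markov n a := h.markov n a
  idem n a he := by
    obtain ⟨T', hT', hE⟩ := exists_specializedTrace hd q hD
    obtain rfl := h.unique hd hD hT'
    have hterm : ∀ s ∈ Finset.range d, T (n + 2) (incl d (n + 1) q a *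
        (t d (n + 2) q ⟨n, by omega⟩ ^ s * t d (n + 2) q ⟨n + 1, by omega⟩ ^ (d - s))) =
        Polynomial.C (xD d D (d - s)) *
          T (n + 1) ((a : Y d (n + 1) q) * t d (n + 1) q (Fin.last n) ^ s) := by
      intro s _
      rw [← h.framing_pow hd hD, map_mul (incl d (n + 1) q),
        map_pow (incl d (n + 1) q), incl_t, ← mul_assoc]
      rfl
    change T (n + 2) (incl d (n + 1) q a * e d (n + 2) q n (by omega)) =
      Polynomial.C (1 / (D.card : ℂ)) * T (n + 1) a
    rw [e_eq, mul_smul_comm, map_smul, Finset.mul_sum, map_sum, Finset.sum_congr rfl hterm, hE,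
      Polynomial.smul_eq_C_mul, ← mul_assoc, ← Polynomial.C_mul, ← mul_assoc,
      one_div_mul_cancel (by exact_mod_cast (by omega : d ≠ 0)), one_mul]
  idem_markov n a _ := h.idem_markov hd n a

end BraidTrace

end YokonumaHecke

end

open YokonumaHecke in
theorem mainTheorem5 (d : ℕ) (q : ℂ) (hq : q ≠ 0) (m : ℕ) (hm : 1 ≤ m) (hmd : m ≤ d) :
    (∃! τ : ∀ n : ℕ, br d n q →ₗ[ℂ] Polynomial ℂ, IsBraidTrace d q m τ) ∧
    ∀ τ : ∀ n : ℕ, br d n q →ₗ[ℂ] Polynomial ℂ, IsBraidTrace d q m τ →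
      ∀ D : Finset (ZMod d), D.card = m →
        (∃! T : ∀ n : ℕ, Y d n q →ₗ[ℂ] Polynomial ℂ, IsSpecializedTrace d q D T) ∧
        ∀ T : ∀ n : ℕ, Y d n q →ₗ[ℂ] Polynomial ℂ, IsSpecializedTrace d q D T →
          ∀ (n : ℕ) (a : br d n q), T n (a : Y d n q) = τ n a := by
  have hd : 1 ≤ d := hm.trans hmd
  refine ⟨?_, ?_⟩
  · have : NeZero d := ⟨by omega⟩
    obtain ⟨D, -, hD⟩ := Finset.exists_subset_card_eq
      (s := (Finset.univ : Finset (ZMod d))) (n := m) (by rwa [Finset.card_univ, ZMod.card])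
    obtain ⟨T, hT, -⟩ := exists_specializedTrace hd q (D := D) (by omega)
    have hτ := hT.isBraidTrace hd (by omega)
    rw [hD] at hτ
    exact ⟨_, hτ, fun τ' hτ' => hτ'.unique hd hτ⟩
  · rintro τ hτ D rfl
    obtain ⟨T, hT, -⟩ := exists_specializedTrace hd q hm
    refine ⟨⟨T, hT, fun T' hT' => hT'.unique hd hm hT⟩, fun T' hT' n a => ?_⟩
    rw [← (hT'.isBraidTrace hd hm).unique hd hτ]
    rfl
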